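/- An \emph{ends space} is a pair $(E,F)$, where $E$ is a totally disconnected, compact, metrizable space and $F\subseteq E$ is closed (possibly empty). Homeomorphisms between subsets $C,D\subseteq E$ are understood relative to $F$, i.e. as homeomorphisms of pairs $(C,C\cap F)\to(D,D\cap F)$, and $\mathrm{Homeo}(E,F)$ is the group of homeomorphisms of $E$ that map $F$ onto $F$. The pair $(E,F)$ is \emph{self-similar} if, for every decomposition $E=E_1\sqcup\dots\sqcup E_n$ into pairwise disjoint clopen sets, some $E_i$ contains a clopen set $D$ with $(D,D\cap F)$ homeomorphic to $(E,F)$. For $x,y\in E$ write $x\preceq y$ if every clopen neighborhood of $y$ contains a clopen set that is homeomorphic (relative to $F$) to some clopen neighborhood of $x$, and $x\sim y$ if $x\preceq y$ and $y\preceq x$. A point $x$ is \emph{maximal} if $x\preceq y$ implies $y\preceq x$; $M(E)$ denotes the set of maximal points. The pair $(E,F)$ is \emph{uniformly self-similar} if it is self-similar and $M(E)$ is a single $\sim$-equivalence class that is homeomorphic to the Cantor set. A \emph{half-space} is a clopen set $H\subseteq E$ such that $H\cap M(E)$ is a non-empty proper subset of $M(E)$. For a half-space $H$, an \emph{$H$-translation}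 is an element $\varphi\in\mathrm{Homeo}(E,F)$ such that the sets $\varphi^n(H)$, $n\in\mathbb Z$, are pairwise disjoint. \textbf{Corollary.} Let $(E,F)$ be a uniformly self-similar ends space. Then half-spaces exist, and the group $\mathrm{Homeo}(E,F)$ \begin{itemize} \item is the normal closure of a single involution (an element of order $2$); \item is, for every half-space $H$, the normal closure of a single $H$-translation; \item is uniformly perfect: there is an $N$ such that every element is a product of at most $N$ commutators. \end{itemize} Moreover, each element of $\mathrm{Homeo}(E,F)$ is a product of at most $3$ commutators; it is also a product of at most $6$ elements, each of which is an $H$-translation for some half-space $H$ (which may depend on the factor); and it is also a product of at most $12$ involutions. -/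

import Mathlib

/-!
An ends space is a pair `(E, F)` with `E` a totally disconnected compact metrizable space and
`F` a closed subset of `E`.  Topological assumptions on `E` and closedness of `F` are carried
by the theorem; the notions below are defined for any subset `F` of a topological space `E`.
-/

namespace EndsSpace

variable {E : Type*} [TopologicalSpace E]

/-- The subsets `A` and `B` of `E` are homeomorphic relative to `F`: there is a homeomorphism
of pairs `(A, A ∩ F) → (B, B ∩ F)`. -/
def PairHomeomorphic (F A B : Set E) : Prop :=
  ∃ h : A ≃ₜ B, ∀ a : A, (h a : E) ∈ F ↔ (a : E) ∈ F

/-- `Homeo(E, F)`: the group (under composition) of the self-homeomorphisms of `E` that map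
`F` onto `F`. -/
def HomeoPair (F : Set E) : Subgroup (E ≃ₜ E) where
  carrier := {φ | φ '' F = F}
  one_mem' := Set.image_id F
  mul_mem' := by
    intro φ ψ hφ hψ
    change (fun x => φ (ψ x)) '' F = F
    rw [← Set.image_image φ ψ F, hψ, hφ]
  inv_mem' := by
    intro φ hφ
    have hφ' : φ '' F = F := hφ
    change φ.symm '' F = F
    conv_lhs => rw [← hφ']
    rw [Set.image_image]
    simp

/-- `(E, F)` is self-similar: whenever `E` is a disjoint union of finitely many clopen sets,
one of them contains a clopen set `D` with `(D, D ∩ F)` homeomorphic to `(E, F)`. -/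
def IsSelfSimilar (F : Set E) : Prop :=
  ∀ (n : ℕ) (P : Fin n → Set E), (∀ i, IsClopen (P i)) →
    Pairwise (fun i j => Disjoint (P i) (P j)) → (⋃ i, P i) = Set.univ →
    ∃ (i : Fin n) (D : Set E), IsClopen D ∧ D ⊆ P i ∧ PairHomeomorphic F D Set.univ

/-- The preorder `x ≼ y` on `E`: every clopen neighborhood `U` of `y` contains a clopen set `W`
that is a homeomorphic copy, relative to `F`, of some clopen neighborhood `V` of `x`. -/
def Below (F : Set E) (x y : E) : Prop :=
  ∀ U : Set E, IsClopen U → y ∈ U →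
    ∃ V W : Set E, IsClopen V ∧ x ∈ V ∧ IsClopen W ∧ W ⊆ U ∧ PairHomeomorphic F V W

/-- The equivalence class `E(x) = {y | x ≼ y and y ≼ x}`. -/
def endClass (F : Set E) (x : E) : Set E := {y | Below F x y ∧ Below F y x}

/-- The set `M(E)` of maximal ends: `x` is maximal if no `y` satisfies `x ≼ y` without
`y ≼ x`. -/
def maximalEnds (F : Set E) : Set E := {x | ∀ y, Below F x y → Below F y x}

/-- `(E, F)` is uniformly self-similar: it is self-similar, and the set of maximal ends is a
single equivalence class that is homeomorphic to the Cantor set `{0,1}^ℕ`. -/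
def IsUniformlySelfSimilar (F : Set E) : Prop :=
  IsSelfSimilar F ∧ (∃ x, maximalEnds F = endClass F x) ∧
    Nonempty (maximalEnds F ≃ₜ (ℕ → Bool))

/-- A half-space of `(E, F)`: a clopen set whose set of maximal ends is a non-empty proper
subset of `M(E)`. -/
def IsHalfSpace (F H : Set E) : Prop :=
  IsClopen H ∧ (H ∩ maximalEnds F).Nonempty ∧ H ∩ maximalEnds F ⊂ maximalEnds F

/-- `φ` is an `H`-translation: `H` is a half-space and the sets `φⁿ(H)`, `n ∈ ℤ`, are
pairwise disjoint. -/
def IsHTranslation (F H : Set E) (φ : HomeoPair F) : Prop :=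
  IsHalfSpace F H ∧
    Pairwise (fun m n : ℤ => Disjoint (((φ ^ m : HomeoPair F) : E ≃ₜ E) '' H)
      (((φ ^ n : HomeoPair F) : E ≃ₜ E) '' H))

end EndsSpace

section GroupNotions

variable {G : Type*} [Group G]

/-- `g` is a product of at most `n` elements, each of which satisfies `P`. -/
def IsProductOfAtMost (n : ℕ) (P : G → Prop) (g : G) : Prop :=
  ∃ l : List G, l.length ≤ n ∧ (∀ x ∈ l, P x) ∧ l.prod = g

/-- `g` is a commutator. -/
def IsCommutator (g : G) : Prop := ∃ a b : G, a * b * a⁻¹ * b⁻¹ = g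

/-- `g` is an involution: an element of order exactly two. -/
def IsInvolution (g : G) : Prop := orderOf g = 2

variable (G) in
/-- `G` is uniformly perfect: for some `N`, every element is a product of at most `N`
commutators. -/
def IsUniformlyPerfect : Prop := ∃ N : ℕ, ∀ g : G, IsProductOfAtMost N IsCommutator g

end GroupNotions

/-!
The maximal ends of a self-similar pair `(E, F)` are the points all of whose clopen neighbourhoods
contain a clopen copy of `(E, F)` (`mem_maximalEnds_iff`). When they form a Cantor set, any two
clopen sets containing maximal ends are homeomorphic relative to `F`
(`IsUniformlySelfSimilar.pairHomeomorphic`). This is a back-and-forth argument in the manner of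
Vaught (`PairHomeomorphic.of_backAndForth`): a piece without maximal ends is matched with a copy of
itself found inside the other set, and pieces with maximal ends can be split at will because no
maximal end is isolated among them.

Consequently every half-space `H` is the zeroth term of a sequence `Hₙ`, `n ∈ ℤ`, of disjoint copies
of `(E, F)` converging to one point (`IsUniformlySelfSimilar.exists_isChart`). A permutation of the
indices, combined with any homeomorphisms of the copies, extends by the identity to a
homeomorphism of `(E, F)`; continuity at the limit point is `continuous_viaEmbedding`. The shift
`φ` is an `H`-translation and the product of the two involutions induced by `n ↦ 1 - n` and
`n ↦ -n`. If `g` is supported in `H` and `a` acts as `g` on every `Hₙ` with `n ≥ 0`, then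
`g = a φ a⁻¹ φ⁻¹`: one commutator, two `H`-translations, four involutions
(`SupportedIn.exists_factorizations`).

Every element is a product of three elements supported in half-spaces
(`IsUniformlySelfSimilar.exists_fragmentation`): an element `f` that moves a maximal end moves a small
half-space `H` off itself and splits as an element supported in the half-space
`H ∪ f(H)` times one supported in the complement of `H`, and one that fixes all maximal ends is
first multiplied by a half-space-supported element that does not. This gives the bounds 3, 6
and 12. Since the group is thereby perfect, commutators of commutators show that any element moving
a half-space off itself normally generates the group
(`IsUniformlySelfSimilar.eq_top_of_disjoint`); this applies to an involution and to a translation.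
-/

namespace EndsSpace

/-! ### A back-and-forth criterion for homeomorphism of pairs -/

/-- A pair of binary trees of clopen subsets of `E` with matching nodes: the children of a node
partition it, matching nodes are both empty or both non-empty, both disjoint from `F` or both not,
and every clopen set of `E` either contains or misses each node of some level. The Boolean argument
of `S` selects the tree; the node below `w` on the branch `b` is `b :: w`. -/
structure MatchedTrees {E : Type*} [TopologicalSpace E] (F : Set E)
    (S : Bool → List Bool → Set E) : Prop where
  isClopen : ∀ s w, IsClopen (S s w)
  nonempty_imp : ∀ s w, (S s w).Nonempty → (S (!s) w).Nonempty
  inter_nonempty_imp : ∀ s w, (S s w ∩ F).Nonempty → (S (!s) w ∩ F).Nonempty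
  union_eq : ∀ s w, S s (true :: w) ∪ S s (false :: w) = S s w
  disjoint : ∀ s w, Disjoint (S s (true :: w)) (S s (false :: w))
  decides : ∀ s C, IsClopen C → ∃ n, ∀ w : List Bool, w.length = n → S s w ⊆ C ∨ S s w ⊆ Cᶜ

namespace MatchedTrees

/-- The point `x` on the side `s` corresponds to `y` on the other side if at every level they lie
in matching nodes. -/
def Rel {E : Type*} (S : Bool → List Bool → Set E) (s : Bool) (x y : E) : Prop :=
  ∀ n, ∃ w : List Bool, w.length = n ∧ x ∈ S s w ∧ y ∈ S (!s) w

theorem Rel.symm {E : Type*} {S : Bool → List Bool → Set E} {s : Bool} {x y : E}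
    (h : Rel S s x y) : Rel S (!s) y x := by
  intro n
  obtain ⟨w, hw, hx, hy⟩ := h n
  exact ⟨w, hw, hy, by simpa using hx⟩

variable {E : Type*} [TopologicalSpace E] {F : Set E} {S : Bool → List Bool → Set E}

theorem exists_mem (hS : MatchedTrees F S) (s : Bool) {x : E} (hx : x ∈ S s []) (n : ℕ) :
    ∃ w : List Bool, w.length = n ∧ x ∈ S s w := by
  induction n with
  | zero => exact ⟨[], rfl, hx⟩
  | succ n ih =>
    obtain ⟨w, hw, hxw⟩ := ih
    rw [← hS.union_eq] at hxw
    rcases hxw with h | h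
    · exact ⟨true :: w, by simp [hw], h⟩
    · exact ⟨false :: w, by simp [hw], h⟩

theorem mem_tail (hS : MatchedTrees F S) {s b : Bool} {w : List Bool} {x : E}
    (hx : x ∈ S s (b :: w)) : x ∈ S s w := by
  rw [← hS.union_eq]
  cases b
  · exact Or.inr hx
  · exact Or.inl hx

theorem eq_of_mem (hS : MatchedTrees F S) {s : Bool} {x : E} :
    ∀ {w v : List Bool}, w.length = v.length → x ∈ S s w → x ∈ S s v → w = v
  | [], [], _, _, _ => rfl
  | b :: w, c :: v, h, hw, hv => by
    have := hS.eq_of_mem (by simpa using h) (hS.mem_tail hw) (hS.mem_tail hv)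
    subst this
    have hd := Set.disjoint_left.1 (hS.disjoint s w)
    cases b <;> cases c <;> first | rfl | exact absurd hw (hd hv) | exact absurd hv (hd hw)

theorem isClosed_level (hS : MatchedTrees F S) (s : Bool) (n : ℕ) :
    IsClosed {p : E × E | ∃ w : List Bool, w.length = n ∧ p.1 ∈ S s w ∧ p.2 ∈ S (!s) w} := by
  have : {p : E × E | ∃ w : List Bool, w.length = n ∧ p.1 ∈ S s w ∧ p.2 ∈ S (!s) w} =
      ⋃ w ∈ {w : List Bool | w.length = n}, S s w ×ˢ S (!s) w := by
    ext p; simp [and_left_comm]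
  rw [this]
  exact (List.finite_length_eq Bool n).isClosed_biUnion fun w _ =>
    (hS.isClopen s w).1.prod (hS.isClopen (!s) w).1

theorem isClosed_rel (hS : MatchedTrees F S) (s : Bool) :
    IsClosed {p : E × E | Rel S s p.1 p.2} := by
  simp only [Rel, Set.ofPred_forall]
  exact isClosed_iInter fun n => hS.isClosed_level s n

theorem exists_rel [CompactSpace E] (hS : MatchedTrees F S) (s : Bool) {x : E}
    (hx : x ∈ S s []) : ∃ y, Rel S s x y := by
  let K : ℕ → Set E := fun n => {y | ∃ w : List Bool, w.length = n ∧ x ∈ S s w ∧ y ∈ S (!s) w}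
  have hcl : ∀ n, IsClosed (K n) := fun n =>
    (hS.isClosed_level s n).preimage (Continuous.prodMk_right x)
  have hK : (⋂ n, K n).Nonempty := by
    refine IsCompact.nonempty_iInter_of_sequence_nonempty_isCompact_isClosed K ?_ ?_
      (hcl 0).isCompact hcl
    · rintro n y ⟨w, hw, hxw, hyw⟩
      cases w with
      | nil => simp at hw
      | cons b w => exact ⟨w, by simpa using hw, hS.mem_tail hxw, hS.mem_tail hyw⟩
    · intro n
      obtain ⟨w, hw, hxw⟩ := hS.exists_mem s hx n
      obtain ⟨y, hy⟩ := hS.nonempty_imp s w ⟨x, hxw⟩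
      exact ⟨y, w, hw, hxw, hy⟩
  obtain ⟨y, hy⟩ := hK
  exact ⟨y, fun n => Set.mem_iInter.1 hy n⟩

theorem Rel.unique [TotallySeparatedSpace E] (hS : MatchedTrees F S) {s : Bool} {x y z : E}
    (hy : Rel S s x y) (hz : Rel S s x z) : y = z := by
  by_contra hne
  obtain ⟨C, hC, hyC, hzC⟩ := exists_isClopen_of_totally_separated hne
  obtain ⟨n, hn⟩ := hS.decides (!s) C hC
  obtain ⟨w, hw, hxw, hyw⟩ := hy n
  obtain ⟨v, hv, hxv, hzv⟩ := hz n
  obtain rfl := hS.eq_of_mem (hw.trans hv.symm) hxw hxv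
  rcases hn w hw with h | h
  · exact hzC (h hzv)
  · exact h hyw hyC

theorem Rel.mem_of_mem [CompactSpace E] [T2Space E] [TotallyDisconnectedSpace E]
    (hF : IsClosed F) (hS : MatchedTrees F S) {s : Bool} {x y : E}
    (h : Rel S s x y) (hx : x ∈ F) : y ∈ F := by
  by_contra hy
  obtain ⟨C, hC, hyC, hCF⟩ := compact_exists_isClopen_in_isOpen hF.isOpen_compl hy
  obtain ⟨n, hn⟩ := hS.decides (!s) C hC
  obtain ⟨w, hw, hxw, hyw⟩ := h n
  obtain ⟨z, hz, hzF⟩ := hS.inter_nonempty_imp s w ⟨x, hxw, hx⟩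
  rcases hn w hw with h | h
  · exact hCF (h hz) hzF
  · exact h hyw hyC

/-- The correspondence is the graph of a homeomorphism between the roots, since it is closed in
the compact space `E × E` and both projections to the roots are bijective. -/
theorem pairHomeomorphic [CompactSpace E] [T2Space E] [TotallyDisconnectedSpace E]
    (hF : IsClosed F) (hS : MatchedTrees F S) : PairHomeomorphic F (S true []) (S false []) := by
  let Z : Set (E × E) := {p : E × E | Rel S true p.1 p.2}
  have hZ : CompactSpace Z := isCompact_iff_compactSpace.1 (hS.isClosed_rel true).isCompact
  have h1 : ∀ p : Z, p.1.1 ∈ S true [] := fun p => by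
    obtain ⟨w, hw, hx, -⟩ := p.2 0
    rw [List.length_eq_zero_iff] at hw
    exact hw ▸ hx
  have h2 : ∀ p : Z, p.1.2 ∈ S false [] := fun p => by
    obtain ⟨w, hw, -, hx⟩ := p.2 0
    rw [List.length_eq_zero_iff] at hw
    exact hw ▸ hx
  let f : Z → S true [] := fun p => ⟨p.1.1, h1 p⟩
  let g : Z → S false [] := fun p => ⟨p.1.2, h2 p⟩
  have hf : Function.Bijective f := by
    constructor
    · rintro ⟨⟨x, y⟩, hp⟩ ⟨⟨x', y'⟩, hp'⟩ hxx
      obtain rfl : x = x' := congrArg Subtype.val hxx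
      obtain rfl : y = y' := Rel.unique hS hp hp'
      rfl
    · rintro ⟨x, hx⟩
      obtain ⟨y, hy⟩ := hS.exists_rel true hx
      exact ⟨⟨(x, y), hy⟩, rfl⟩
  have hg : Function.Bijective g := by
    constructor
    · rintro ⟨⟨x, y⟩, hp⟩ ⟨⟨x', y'⟩, hp'⟩ hxx
      obtain rfl : y = y' := congrArg Subtype.val hxx
      obtain rfl : x = x' := Rel.unique hS (Rel.symm hp) (Rel.symm hp')
      rfl
    · rintro ⟨y, hy⟩
      obtain ⟨x, hx⟩ := hS.exists_rel false hy
      exact ⟨⟨(x, y), hx.symm⟩, rfl⟩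
  have hfc : Continuous f := by fun_prop
  have hgc : Continuous g := by fun_prop
  let f' : Z ≃ₜ S true [] := Continuous.homeoOfEquivCompactToT2 (f := Equiv.ofBijective f hf) hfc
  let g' : Z ≃ₜ S false [] := Continuous.homeoOfEquivCompactToT2 (f := Equiv.ofBijective g hg) hgc
  refine ⟨f'.symm.trans g', fun a => ?_⟩
  obtain ⟨p, rfl⟩ := f'.surjective a
  simp only [Homeomorph.trans_apply, Homeomorph.symm_apply_apply]
  exact ⟨fun h => Rel.mem_of_mem hF hS (Rel.symm p.2) h, fun h => Rel.mem_of_mem hF hS p.2 h⟩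

end MatchedTrees

section BackAndForth

variable {E : Type*} [TopologicalSpace E] [CompactSpace E] [T2Space E]
  [TotallyDisconnectedSpace E]

/-- Vaught's back-and-forth criterion: a symmetric relation between clopen sets whose related
pairs can be split along any clopen set, and which respects emptiness and disjointness from `F`,
relates only homeomorphic pairs. -/
theorem PairHomeomorphic.of_backAndForth [SecondCountableTopology E] {F : Set E} (hF : IsClosed F)
    (R : Set E → Set E → Prop) (hsymm : ∀ {A B}, R A B → R B A)
    (hclopen : ∀ {A B}, R A B → IsClopen A)
    (hne : ∀ {A B}, R A B → A.Nonempty → B.Nonempty)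
    (hneF : ∀ {A B}, R A B → (A ∩ F).Nonempty → (B ∩ F).Nonempty)
    (hsplit : ∀ {A B C}, R A B → IsClopen C → ∃ D, R (A ∩ C) (B ∩ D) ∧ R (A \ C) (B \ D))
    {A B : Set E} (hAB : R A B) : PairHomeomorphic F A B := by
  have : Countable (TopologicalSpace.Clopens E) :=
    TopologicalSpace.Clopens.countable_iff_secondCountable.2 inferInstance
  obtain ⟨C, hC⟩ := exists_surjective_nat (TopologicalSpace.Clopens E)
  -- the step splits along a prescribed clopen set on the side `s`
  have step : ∀ (P : {P : Bool → Set E // R (P true) (P false)}) (s : Bool) (k : ℕ),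
      ∃ Q : Bool → Set E, Q s = C k ∧
        ∀ b : Bool, R (if b then P.1 true ∩ Q true else P.1 true \ Q true)
          (if b then P.1 false ∩ Q false else P.1 false \ Q false) := by
    rintro ⟨P, hP⟩ s k
    cases s
    · obtain ⟨D, h1, h2⟩ := hsplit (hsymm hP) (C k).isClopen
      refine ⟨fun b => if b then D else C k, by simp, fun b => ?_⟩
      cases b
      · simpa using hsymm h2
      · simpa using hsymm h1
    · obtain ⟨D, h1, h2⟩ := hsplit hP (C k).isClopen
      refine ⟨fun b => if b then C k else D, by simp, fun b => ?_⟩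
      cases b
      · simpa using h2
      · simpa using h1
  choose Q hQs hQR using step
  -- level `2k` splits along `C k` on the left, level `2k + 1` on the right
  let T : List Bool → {P : Bool → Set E // R (P true) (P false)} := fun w =>
    List.rec ⟨fun b => if b then A else B, by simpa using hAB⟩
      (fun b w P => ⟨fun s => if b then P.1 s ∩ Q P (w.length.bodd) (w.length.div2) s
        else P.1 s \ Q P (w.length.bodd) (w.length.div2) s, hQR P _ _ b⟩) w
  let S : Bool → List Bool → Set E := fun s w => (T w).1 s
  have hcons : ∀ s b w, S s (b :: w) = if b then S s w ∩ Q (T w) (w.length.bodd) (w.length.div2) s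
      else S s w \ Q (T w) (w.length.bodd) (w.length.div2) s := fun s b w => rfl
  have hS : MatchedTrees F S := by
    refine ⟨fun s w => ?_, fun s w => ?_, fun s w => ?_, fun s w => ?_, fun s w => ?_,
      fun s K hK => ?_⟩
    · cases s
      · exact hclopen (hsymm (T w).2)
      · exact hclopen (T w).2
    · cases s
      · exact hne (hsymm (T w).2)
      · exact hne (T w).2
    · cases s
      · exact hneF (hsymm (T w).2)
      · exact hneF (T w).2
    · simp [hcons]
    · simpa [hcons] using Set.disjoint_sdiff_right.mono_left Set.inter_subset_right
    · obtain ⟨k, hk⟩ := hC ⟨K, hK⟩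
      refine ⟨Nat.bit s k + 1, fun w hw => ?_⟩
      cases w with
      | nil => simp at hw
      | cons b w =>
        have hw' : w.length = Nat.bit s k := by simpa using hw
        have hQ : Q (T w) (w.length.bodd) (w.length.div2) s = K := by
          rw [hw', Nat.bodd_bit, Nat.div2_bit, hQs, hk]; rfl
        rw [hcons, hQ]
        cases b
        · exact Or.inr fun x hx => by simpa using hx.2
        · exact Or.inl fun x hx => by simpa using hx.2
  simpa [S, T] using hS.pairHomeomorphic hF

end BackAndForth

/-! ### Homeomorphisms of pairs as maps of the ambient space -/

section Pairs

variable {E : Type*} [TopologicalSpace E]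

theorem PairHomeomorphic.symm {F A B : Set E} (h : PairHomeomorphic F A B) :
    PairHomeomorphic F B A := by
  obtain ⟨e, he⟩ := h
  exact ⟨e.symm, fun b => by simpa using (he (e.symm b)).symm⟩

/-- `f` restricts to a homeomorphism from `A` onto `B` relative to `F`; for compact `A` in a
Hausdorff space, continuity of the inverse is automatic. -/
structure IsPairMap (F A B : Set E) (f : E → E) : Prop where
  continuousOn : ContinuousOn f A
  injOn : Set.InjOn f A
  image_eq : f '' A = B
  mem_iff : ∀ x ∈ A, f x ∈ F ↔ x ∈ F

theorem PairHomeomorphic.exists_isPairMap {F A B : Set E} (h : PairHomeomorphic F A B) :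
    ∃ f, IsPairMap F A B f := by
  classical
  obtain ⟨e, he⟩ := h
  let f : E → E := fun x => if h : x ∈ A then e ⟨x, h⟩ else x
  have hf : ∀ a : A, f a = e a := fun a => by simp [f]
  refine ⟨f, ?_, fun x hx y hy hxy => ?_, ?_, fun x hx => ?_⟩
  · rw [continuousOn_iff_continuous_domRestrict]
    have : A.domRestrict f = fun a => (e a : E) := funext hf
    rw [this]
    fun_prop
  · rw [hf ⟨x, hx⟩, hf ⟨y, hy⟩] at hxy
    exact congrArg Subtype.val (e.injective (Subtype.ext hxy))
  · ext y
    constructor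
    · rintro ⟨x, hx, rfl⟩
      rw [hf ⟨x, hx⟩]
      exact (e _).2
    · intro hy
      exact ⟨e.symm ⟨y, hy⟩, (e.symm ⟨y, hy⟩).2, by rw [hf]; simp⟩
  · rw [hf ⟨x, hx⟩]
    exact he ⟨x, hx⟩

theorem IsPairMap.pairHomeomorphic [T2Space E] {F A B : Set E} {f : E → E}
    (hf : IsPairMap F A B f) (hA : IsCompact A) : PairHomeomorphic F A B := by
  obtain ⟨hc, hi, rfl, hF⟩ := hf
  have := isCompact_iff_compactSpace.1 hA
  let e : A ≃ f '' A := Equiv.Set.imageOfInjOn f A hi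
  have he : Continuous e := (continuousOn_iff_continuous_domRestrict.1 hc).subtype_mk _
  exact ⟨Continuous.homeoOfEquivCompactToT2 (f := e) he, fun a => hF a a.2⟩

theorem IsPairMap.mono {F A B A' : Set E} {f : E → E} (hf : IsPairMap F A B f) (h : A' ⊆ A) :
    IsPairMap F A' (f '' A') f :=
  ⟨hf.continuousOn.mono h, hf.injOn.mono h, rfl, fun x hx => hf.mem_iff x (h hx)⟩

theorem IsPairMap.image_diff {F A B C : Set E} {f : E → E} (hf : IsPairMap F A B f) :
    f '' (A \ C) = B \ f '' (A ∩ C) := by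
  rw [← hf.image_eq, ← Set.sdiff_inter_self_eq_sdiff, Set.inter_comm,
    hf.injOn.image_sdiff_subset Set.inter_subset_left]

theorem IsPairMap.isClopen_image [CompactSpace E] [T2Space E] {F A B C : Set E} {f : E → E}
    (hf : IsPairMap F A B f) (hA : IsClopen A) (hB : IsClopen B) (hC : IsClopen C) :
    IsClopen (f '' (A ∩ C)) := by
  have h1 : IsClosed (f '' (A ∩ C)) :=
    ((hA.1.inter hC.1).isCompact.image_of_continuousOn
      (hf.continuousOn.mono Set.inter_subset_left)).isClosed
  have h2 : IsClosed (f '' (A \ C)) :=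
    ((hA.diff hC).1.isCompact.image_of_continuousOn
      (hf.continuousOn.mono Set.sdiff_subset)).isClosed
  refine ⟨h1, ?_⟩
  have : f '' (A ∩ C) = B \ f '' (A \ C) := by
    rw [hf.image_diff, Set.sdiff_sdiff_cancel_left]
    rw [← hf.image_eq]
    exact Set.image_mono Set.inter_subset_left
  rw [this]
  exact hB.2.sdiff h2

/-- `f` embeds the pair `(E, F)` onto a clopen subset of itself. -/
structure IsCopyMap (F : Set E) (f : E → E) : Prop where
  isOpenEmbedding : Topology.IsOpenEmbedding f
  mem_iff : ∀ x, f x ∈ F ↔ x ∈ F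

theorem IsCopyMap.comp {F : Set E} {f g : E → E} (hf : IsCopyMap F f) (hg : IsCopyMap F g) :
    IsCopyMap F (f ∘ g) :=
  ⟨hf.1.comp hg.1, fun x => (hf.2 _).trans (hg.2 x)⟩

/-- `U` contains a clopen copy of the pair `(E, F)`. -/
def HasCopy (F U : Set E) : Prop := ∃ f, IsCopyMap F f ∧ Set.range f ⊆ U

theorem IsPairMap.isCopyMap [CompactSpace E] [T2Space E] {F D : Set E} {f : E → E}
    (hf : IsPairMap F Set.univ D f) (hD : IsClopen D) : IsCopyMap F f := by
  have hc : Continuous f := continuousOn_univ.1 hf.continuousOn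
  have hi : Function.Injective f := Set.injOn_univ.1 hf.injOn
  refine ⟨⟨(hc.isClosedEmbedding hi).isEmbedding, ?_⟩, fun x => hf.mem_iff x trivial⟩
  rw [← Set.image_univ, hf.image_eq]
  exact hD.2

theorem hasCopy_iff [CompactSpace E] [T2Space E] {F U : Set E} :
    HasCopy F U ↔ ∃ D, IsClopen D ∧ D ⊆ U ∧ PairHomeomorphic F D Set.univ := by
  constructor
  · rintro ⟨f, hf, hU⟩
    refine ⟨Set.range f, ⟨(isCompact_range hf.1.continuous).isClosed, hf.1.isOpen_range⟩, hU, ?_⟩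
    refine (IsPairMap.pairHomeomorphic (f := f) ?_ isCompact_univ).symm
    exact ⟨hf.1.continuous.continuousOn, hf.1.injective.injOn, Set.image_univ, fun x _ => hf.2 x⟩
  · rintro ⟨D, hD, hU, h⟩
    obtain ⟨f, hf⟩ := h.symm.exists_isPairMap
    refine ⟨f, hf.isCopyMap hD, ?_⟩
    rw [← Set.image_univ, hf.image_eq]
    exact hU

theorem IsCopyMap.isClopen_image [CompactSpace E] [T2Space E] {F A : Set E} {f : E → E}
    (hf : IsCopyMap F f) (hA : IsClopen A) : IsClopen (f '' A) :=
  ⟨(hA.1.isCompact.image hf.1.continuous).isClosed, hf.1.isOpenMap _ hA.2⟩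

theorem IsCopyMap.pairHomeomorphic_image [CompactSpace E] [T2Space E] {F A : Set E} {f : E → E}
    (hf : IsCopyMap F f) (hA : IsClopen A) : PairHomeomorphic F A (f '' A) :=
  IsPairMap.pairHomeomorphic
    ⟨hf.1.continuous.continuousOn, hf.1.injective.injOn, rfl, fun x _ => hf.2 x⟩ hA.1.isCompact

end Pairs

/-! ### Maximal ends of a self-similar pair -/

section Maximal

variable {E : Type*} [TopologicalSpace E] [CompactSpace E] [T2Space E]

theorem HasCopy.or_of_union {F U V : Set E} (hss : IsSelfSimilar F) (hU : IsClopen U)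
    (h : HasCopy F (U ∪ V)) : HasCopy F U ∨ HasCopy F V := by
  obtain ⟨f, hf, hUV⟩ := h
  have hP : IsClopen (f ⁻¹' U) := hU.preimage hf.1.continuous
  obtain ⟨i, D, hD, hDi, hDE⟩ := hss 2 ![f ⁻¹' U, (f ⁻¹' U)ᶜ]
    (by intro i; fin_cases i; exacts [hP, hP.compl])
    (by
      intro i j hij
      fin_cases i <;> fin_cases j <;> simp_all [disjoint_compl_right, disjoint_compl_left])
    (by ext x; simp [Fin.exists_fin_two, em])
  obtain ⟨g, hg, hgD⟩ := hasCopy_iff.2 ⟨D, hD, hDi, hDE⟩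
  fin_cases i
  · refine Or.inl ⟨f ∘ g, hf.comp hg, ?_⟩
    rintro _ ⟨x, rfl⟩
    exact hgD ⟨x, rfl⟩
  · refine Or.inr ⟨f ∘ g, hf.comp hg, ?_⟩
    rintro _ ⟨x, rfl⟩
    have h1 : f (g x) ∉ U := hgD ⟨x, rfl⟩
    exact (hUV ⟨g x, rfl⟩).resolve_left h1

theorem exists_forall_hasCopy {F : Set E} (hss : IsSelfSimilar F) :
    ∃ x : E, ∀ U, IsClopen U → x ∈ U → HasCopy F U := by
  by_contra! hno
  have key : ∃ U, IsClopen U ∧ (Set.univ : Set E) ⊆ U ∧ ¬ HasCopy F U := by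
    refine isCompact_univ.induction_on (p := fun s => ∃ U, IsClopen U ∧ s ⊆ U ∧ ¬ HasCopy F U)
      ?_ ?_ ?_ ?_
    · refine ⟨∅, isClopen_empty, le_rfl, ?_⟩
      intro h
      obtain ⟨i, -⟩ := hss 0 (fun _ => ∅) (fun i => i.elim0) (fun i => i.elim0) (by
        obtain ⟨f, hf, hr⟩ := h
        ext x
        exact (hr ⟨x, rfl⟩).elim)
      exact i.elim0
    · rintro s t hst ⟨U, hU, htU, hc⟩
      exact ⟨U, hU, hst.trans htU, hc⟩
    · rintro s t ⟨U, hU, hsU, hUc⟩ ⟨V, hV, htV, hVc⟩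
      refine ⟨U ∪ V, hU.union hV, Set.union_subset_union hsU htV, fun h => ?_⟩
      exact (h.or_of_union hss hU).elim hUc hVc
    · intro x _
      obtain ⟨U, hU, hxU, hc⟩ := hno x
      exact ⟨U, mem_nhdsWithin_of_mem_nhds (hU.2.mem_nhds hxU), U, hU, le_rfl, hc⟩
  obtain ⟨U, -, hU, hc⟩ := key
  exact hc ⟨id, ⟨Topology.IsOpenEmbedding.id, fun _ => Iff.rfl⟩, (Set.subset_univ _).trans hU⟩

/-- The maximal ends of a self-similar pair are the points all of whose clopen neighbourhoods
contain a copy of the whole pair. -/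
theorem mem_maximalEnds_iff {F : Set E} (hss : IsSelfSimilar F) {x : E} :
    x ∈ maximalEnds F ↔ ∀ U, IsClopen U → x ∈ U → HasCopy F U := by
  have below : ∀ {x₀ : E}, (∀ U, IsClopen U → x₀ ∈ U → HasCopy F U) → ∀ y, Below F y x₀ := by
    intro x₀ h y U hU hxU
    obtain ⟨D, hD, hDU, hDE⟩ := hasCopy_iff.1 (h U hU hxU)
    exact ⟨Set.univ, D, isClopen_univ, trivial, hD, hDU, hDE.symm⟩
  constructor
  · intro hx U hU hxU
    obtain ⟨x₀, hx₀⟩ := exists_forall_hasCopy hss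
    obtain ⟨V, W, hV, hx₀V, hW, hWU, hVW⟩ := hx x₀ (below hx₀ x) U hU hxU
    obtain ⟨f, hf, hfV⟩ := hx₀ V hV hx₀V
    obtain ⟨g, hg⟩ := hVW.exists_isPairMap
    have hgf : IsPairMap F Set.univ (g '' Set.range f) (g ∘ f) := by
      refine ⟨?_, ?_, ?_, ?_⟩
      · exact (hg.continuousOn.comp hf.1.continuous.continuousOn fun y _ => hfV ⟨y, rfl⟩)
      · intro a _ b _ hab
        exact hf.1.injective (hg.injOn (hfV ⟨a, rfl⟩) (hfV ⟨b, rfl⟩) hab)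
      · rw [Set.image_univ, Set.range_comp]
      · intro a _
        exact (hg.mem_iff _ (hfV ⟨a, rfl⟩)).trans (hf.2 a)
    refine ⟨g ∘ f, hgf.isCopyMap ?_, ?_⟩
    · rw [← Set.inter_eq_self_of_subset_right hfV]
      refine hg.isClopen_image hV hW ?_
      rw [← Set.image_univ]
      exact hf.isClopen_image isClopen_univ
    · rw [Set.range_comp]
      refine Set.Subset.trans (Set.image_mono hfV) ?_
      rw [hg.image_eq]
      exact hWU
  · intro hx y _
    exact below hx y

end Maximal
section HalfSpace

variable {E : Type*} [TopologicalSpace E] {F : Set E}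

theorem isHalfSpace_iff {H : Set E} : IsHalfSpace F H ↔
    IsClopen H ∧ (H ∩ maximalEnds F).Nonempty ∧ (Hᶜ ∩ maximalEnds F).Nonempty := by
  refine and_congr_right fun _ => and_congr_right fun _ => ⟨fun h => ?_, fun ⟨x, hx, hxM⟩ => ?_⟩
  · obtain ⟨x, hx, hxH⟩ := Set.exists_of_ssubset h
    exact ⟨x, fun h => hxH ⟨h, hx⟩, hx⟩
  · exact Set.ssubset_iff_subset_ne.2 ⟨Set.inter_subset_right, fun h => hx (h.symm ▸ hxM).1⟩

theorem IsHalfSpace.compl {H : Set E} (hH : IsHalfSpace F H) : IsHalfSpace F Hᶜ := by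
  rw [isHalfSpace_iff] at hH ⊢
  exact ⟨hH.1.compl, hH.2.2, by rw [compl_compl]; exact hH.2.1⟩

end HalfSpace

/-! ### Homogeneity of clopen sets meeting the maximal ends -/

section Homogeneity

variable {E : Type*} [TopologicalSpace E] {F : Set E}

/-- No maximal end is isolated among the maximal ends, since the Cantor set is perfect. -/
theorem IsUniformlySelfSimilar.infinite_inter (hE : IsUniformlySelfSimilar F) {U : Set E} {x : E}
    (hU : IsOpen U) (hxU : x ∈ U) (hx : x ∈ maximalEnds F) : (U ∩ maximalEnds F).Infinite := by
  obtain ⟨e⟩ := hE.2.2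
  let φ : (ℕ → Bool) → E := fun a => e.symm a
  have hφ : Continuous φ := continuous_subtype_val.comp e.symm.continuous
  have hinj : Function.Injective φ := Subtype.val_injective.comp e.symm.injective
  have hopen : IsOpen (φ ⁻¹' U) := hU.preimage hφ
  have hmem : e ⟨x, hx⟩ ∈ φ ⁻¹' U := by simpa [φ] using hxU
  -- flipping a single far coordinate stays inside a given open set
  let a := e ⟨x, hx⟩
  have hlim : Filter.Tendsto (fun n => Function.update a n (!a n)) Filter.atTop (nhds a) := by
    rw [tendsto_pi_nhds]
    intro k
    refine tendsto_const_nhds.congr' ?_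
    filter_upwards [Filter.eventually_gt_atTop k] with n hn
    rw [Function.update_of_ne hn.ne]
  have hev := hlim.eventually (hopen.mem_nhds hmem)
  obtain ⟨N, hN⟩ := Filter.eventually_atTop.1 hev
  refine Set.infinite_of_injective_forall_mem (f := fun n : ℕ =>
    φ (Function.update a (N + n) (!a (N + n)))) ?_ fun n => ⟨hN _ (by omega), (e.symm _).2⟩
  intro m n hmn
  by_contra hne
  have h1 := congrFun (hinj hmn) (N + m)
  rw [Function.update_self, Function.update_of_ne (by omega)] at h1
  exact Bool.not_ne_self _ h1

variable [CompactSpace E] [T2Space E]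

theorem HasCopy.of_inter_nonempty (hE : IsUniformlySelfSimilar F) {A : Set E} (hA : IsClopen A)
    (h : (A ∩ maximalEnds F).Nonempty) : HasCopy F A := by
  obtain ⟨x, hxA, hx⟩ := h
  exact (mem_maximalEnds_iff hE.1).1 hx A hA hxA

variable [TotallyDisconnectedSpace E]

/-- A clopen set with a maximal end splits into two such sets, one of them around any prescribed
maximal end. -/
theorem IsUniformlySelfSimilar.exists_split (hE : IsUniformlySelfSimilar F) {A : Set E}
    (hA : IsClopen A) {x : E} (hxA : x ∈ A) (hx : x ∈ maximalEnds F) :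
    ∃ D, IsClopen D ∧ D ⊆ A ∧ x ∈ D ∧ ((A \ D) ∩ maximalEnds F).Nonempty := by
  obtain ⟨y, ⟨hyA, hy⟩, hyx⟩ := (hE.infinite_inter hA.2 hxA hx).exists_notMem_finset {x}
  have hxy : x ≠ y := fun h => hyx (by simp [h])
  obtain ⟨C, hC, hxC, hyC⟩ := exists_isClopen_of_totally_separated hxy
  exact ⟨A ∩ C, hA.inter hC, Set.inter_subset_left, ⟨hxA, hxC⟩, y, ⟨hyA, fun h => hyC h.2⟩, hy⟩

theorem IsUniformlySelfSimilar.exists_copy_diff (hE : IsUniformlySelfSimilar F) {A B : Set E}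
    (hA : IsClopen A) (hB : IsClopen B) (h : (B ∩ maximalEnds F).Nonempty) :
    ∃ D, IsClopen D ∧ D ⊆ B ∧ PairHomeomorphic F A D ∧ ((B \ D) ∩ maximalEnds F).Nonempty := by
  obtain ⟨x, hxB, hx⟩ := h
  obtain ⟨C, hC, hCB, hxC, hBC⟩ := hE.exists_split hB hxB hx
  obtain ⟨f, hf, hfC⟩ := HasCopy.of_inter_nonempty hE hC ⟨x, hxC, hx⟩
  have hAC : f '' A ⊆ C := (Set.image_subset_range f A).trans hfC
  refine ⟨f '' A, hf.isClopen_image hA, hAC.trans hCB, hf.pairHomeomorphic_image hA,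
    hBC.mono ?_⟩
  gcongr

/-- Any two clopen sets that contain maximal ends are homeomorphic relative to `F`: a clopen
piece without maximal ends can be matched with a copy of itself, and the rest can be split
freely, so the back-and-forth criterion applies. -/
theorem IsUniformlySelfSimilar.pairHomeomorphic [SecondCountableTopology E]
    (hF : IsClosed F) (hE : IsUniformlySelfSimilar F) {A B : Set E} (hA : IsClopen A)
    (hB : IsClopen B) (hAM : (A ∩ maximalEnds F).Nonempty) (hBM : (B ∩ maximalEnds F).Nonempty) :
    PairHomeomorphic F A B := by
  let R : Set E → Set E → Prop := fun A B => IsClopen A ∧ IsClopen B ∧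
    (((A ∩ maximalEnds F).Nonempty ∧ (B ∩ maximalEnds F).Nonempty) ∨ PairHomeomorphic F A B)
  refine PairHomeomorphic.of_backAndForth hF R ?_ ?_ ?_ ?_ ?_ ⟨hA, hB, Or.inl ⟨hAM, hBM⟩⟩
  · rintro A B ⟨hA, hB, h | h⟩
    exacts [⟨hB, hA, Or.inl h.symm⟩, ⟨hB, hA, Or.inr h.symm⟩]
  · exact fun h => h.1
  · rintro A B ⟨hA, hB, h | ⟨e, -⟩⟩ hne
    · exact h.2.mono Set.inter_subset_left
    · obtain ⟨x, hx⟩ := hne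
      exact ⟨e ⟨x, hx⟩, (e _).2⟩
  · rintro A B ⟨hA, hB, h | ⟨e, he⟩⟩ ⟨x, hxA, hxF⟩
    · obtain ⟨f, hf, hfB⟩ := HasCopy.of_inter_nonempty hE hB h.2
      exact ⟨f x, hfB ⟨x, rfl⟩, (hf.mem_iff x).2 hxF⟩
    · exact ⟨e ⟨x, hxA⟩, (e _).2, (he _).2 hxF⟩
  · rintro A B C ⟨hA, hB, ⟨hAM, hBM⟩ | h⟩ hC
    · by_cases h1 : ((A ∩ C) ∩ maximalEnds F).Nonempty
      · by_cases h2 : ((A \ C) ∩ maximalEnds F).Nonempty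
        · obtain ⟨x, hxB, hx⟩ := hBM
          obtain ⟨D, hD, hDB, hxD, hBD⟩ := hE.exists_split hB hxB hx
          exact ⟨D, ⟨hA.inter hC, hB.inter hD, Or.inl ⟨h1, x, ⟨hxB, hxD⟩, hx⟩⟩,
            ⟨hA.diff hC, hB.diff hD, Or.inl ⟨h2, hBD⟩⟩⟩
        · obtain ⟨D, hD, hDB, hAD, hBD⟩ := hE.exists_copy_diff (hA.diff hC) hB hBM
          refine ⟨B \ D, ⟨hA.inter hC, hB.inter (hB.diff hD), Or.inl ⟨h1, ?_⟩⟩,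
            ⟨hA.diff hC, hB.diff (hB.diff hD), Or.inr ?_⟩⟩
          · rwa [Set.inter_eq_self_of_subset_right Set.sdiff_subset]
          · rwa [Set.sdiff_sdiff_cancel_left hDB]
      · have h2 : ((A \ C) ∩ maximalEnds F).Nonempty := by
          obtain ⟨x, hxA, hx⟩ := hAM
          exact ⟨x, ⟨hxA, fun hxC => h1 ⟨x, ⟨hxA, hxC⟩, hx⟩⟩, hx⟩
        obtain ⟨D, hD, hDB, hAD, hBD⟩ := hE.exists_copy_diff (hA.inter hC) hB hBM
        refine ⟨D, ⟨hA.inter hC, hB.inter hD, Or.inr ?_⟩,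
          ⟨hA.diff hC, hB.diff hD, Or.inl ⟨h2, hBD⟩⟩⟩
        rwa [Set.inter_eq_self_of_subset_right hDB]
    · obtain ⟨f, hf⟩ := h.exists_isPairMap
      have hD := hf.isClopen_image hA hB hC
      have hDB : f '' (A ∩ C) ⊆ B := by
        rw [← hf.image_eq]
        exact Set.image_mono Set.inter_subset_left
      refine ⟨f '' (A ∩ C), ⟨hA.inter hC, hB.inter hD, Or.inr ?_⟩,
        ⟨hA.diff hC, hB.diff hD, Or.inr ?_⟩⟩
      · rw [Set.inter_eq_self_of_subset_right hDB]
        exact (hf.mono Set.inter_subset_left).pairHomeomorphic (hA.inter hC).1.isCompact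
      · rw [← hf.image_diff]
        exact (hf.mono Set.sdiff_subset).pairHomeomorphic (hA.diff hC).1.isCompact

theorem IsUniformlySelfSimilar.exists_isCopyMap_range_eq [SecondCountableTopology E]
    (hF : IsClosed F) (hE : IsUniformlySelfSimilar F) {A : Set E} (hA : IsClopen A)
    (hAM : (A ∩ maximalEnds F).Nonempty) : ∃ f, IsCopyMap F f ∧ Set.range f = A := by
  obtain ⟨f, hf⟩ := (hE.pairHomeomorphic hF isClopen_univ hA
    (hAM.mono (Set.inter_subset_inter_left _ (Set.subset_univ _))) hAM).exists_isPairMap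
  exact ⟨f, hf.isCopyMap hA, by rw [← Set.image_univ, hf.image_eq]⟩

theorem IsUniformlySelfSimilar.exists_isHalfSpace (hE : IsUniformlySelfSimilar F) :
    ∃ H, IsHalfSpace F H := by
  obtain ⟨x, hx⟩ := exists_forall_hasCopy hE.1
  have hx := (mem_maximalEnds_iff hE.1).2 hx
  obtain ⟨D, hD, -, hxD, hne⟩ := hE.exists_split isClopen_univ (Set.mem_univ x) hx
  exact ⟨D, isHalfSpace_iff.2 ⟨hD, ⟨x, hxD, hx⟩, by rwa [Set.compl_eq_univ_sdiff]⟩⟩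

/-- Given a maximal end `p` in a clopen set `V`, there are pairwise disjoint clopen subsets of
`V ∖ {p}`, each with a maximal end, that converge to `p`: they are the differences of a
decreasing clopen neighbourhood basis. -/
theorem IsUniformlySelfSimilar.exists_clopen_seq [SecondCountableTopology E]
    (hE : IsUniformlySelfSimilar F) {V : Set E} (hV : IsClopen V) {p : E} (hpV : p ∈ V)
    (hp : p ∈ maximalEnds F) : ∃ K : ℕ → Set E, (∀ n, IsClopen (K n)) ∧
      (∀ n, (K n ∩ maximalEnds F).Nonempty) ∧ (∀ n, K n ⊆ V) ∧
      Pairwise (fun m n => Disjoint (K m) (K n)) ∧ (∀ n, p ∉ K n) ∧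
      ∀ W, IsOpen W → p ∈ W → ∃ N, ∀ n, N ≤ n → K n ⊆ W := by
  obtain ⟨B, hB⟩ := (nhds p).exists_antitone_basis
  have step : ∀ (n : ℕ) (U : {U : Set E // IsClopen U ∧ p ∈ U}),
      ∃ U' : {U : Set E // IsClopen U ∧ p ∈ U}, U'.1 ⊆ U.1 ∩ B n ∧
        ((U.1 \ U'.1) ∩ maximalEnds F).Nonempty := by
    rintro n ⟨U, hU, hpU⟩
    obtain ⟨D, hD, hDU, hpD, hne⟩ := hE.exists_split hU hpU hp
    obtain ⟨C, hC, hpC, hCB⟩ := compact_exists_isClopen_in_isOpen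
      (U := interior (B n)) isOpen_interior (mem_interior_iff_mem_nhds.2 (hB.1.mem_of_mem trivial))
    refine ⟨⟨D ∩ C, hD.inter hC, hpD, hpC⟩, fun x hx => ⟨hDU hx.1, interior_subset (hCB hx.2)⟩,
      hne.mono ?_⟩
    gcongr
    exact Set.inter_subset_left
  choose next hnext hnextM using step
  let U : ℕ → {U : Set E // IsClopen U ∧ p ∈ U} := fun n =>
    Nat.rec ⟨V, hV, hpV⟩ (fun n U => next n U) n
  have hU : ∀ n, (U (n + 1)).1 ⊆ (U n).1 ∩ B n := fun n => hnext n (U n)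
  have hanti : Antitone fun n => (U n).1 :=
    antitone_nat_of_succ_le fun n => (hU n).trans Set.inter_subset_left
  have hdis : ∀ m n, m < n → Disjoint ((U m).1 \ (U (m + 1)).1) ((U n).1 \ (U (n + 1)).1) := by
    intro m n hmn
    refine Set.disjoint_left.2 fun x hx hx' => hx.2 (hanti (Nat.succ_le_of_lt hmn) hx'.1)
  refine ⟨fun n => (U n).1 \ (U (n + 1)).1, fun n => (U n).2.1.diff (U (n + 1)).2.1,
    fun n => hnextM n (U n), fun n => Set.sdiff_subset.trans (hanti (Nat.zero_le n)),
    fun m n hmn => ?_, fun n h => h.2 (U (n + 1)).2.2, fun W hW hpW => ?_⟩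
  · rcases lt_or_gt_of_ne hmn with h | h
    · exact hdis m n h
    · exact (hdis n m h).symm
  · obtain ⟨N, -, hN⟩ := hB.1.mem_iff.1 (hW.mem_nhds hpW)
    refine ⟨N + 1, fun n hn => Set.sdiff_subset.trans ((hanti hn).trans ?_)⟩
    exact ((hU N).trans Set.inter_subset_right).trans hN

end Homogeneity

/-! ### Supports and translations -/

section Group

variable {E : Type*} [TopologicalSpace E] {F : Set E}

theorem mem_homeoPair_iff {φ : E ≃ₜ E} : φ ∈ HomeoPair F ↔ ∀ x, φ x ∈ F ↔ x ∈ F := by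
  change φ '' F = F ↔ _
  constructor
  · intro h x
    conv_lhs => rw [← h]
    exact φ.injective.mem_set_image
  · intro h
    ext y
    obtain ⟨x, rfl⟩ := φ.surjective y
    rw [h, φ.injective.mem_set_image]

theorem HomeoPair.mem_iff (φ : HomeoPair F) (x : E) : φ.1 x ∈ F ↔ x ∈ F :=
  mem_homeoPair_iff.1 φ.2 x

theorem HomeoPair.ext {φ ψ : HomeoPair F} (h : ∀ x, φ.1 x = ψ.1 x) : φ = ψ :=
  Subtype.ext (Homeomorph.ext h)

theorem HomeoPair.mul_apply (φ ψ : HomeoPair F) (x : E) : (φ * ψ).1 x = φ.1 (ψ.1 x) := rfl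

theorem HomeoPair.inv_apply_self (φ : HomeoPair F) (x : E) : φ⁻¹.1 (φ.1 x) = x :=
  φ.1.symm_apply_apply x

theorem HomeoPair.apply_inv_self (φ : HomeoPair F) (x : E) : φ.1 (φ⁻¹.1 x) = x :=
  φ.1.apply_symm_apply x

/-- `g` is supported in `H`: it fixes every point outside `H`. -/
def SupportedIn (H : Set E) (g : HomeoPair F) : Prop := ∀ x, x ∉ H → g.1 x = x

theorem SupportedIn.inv {H : Set E} {g : HomeoPair F} (hg : SupportedIn H g) :
    SupportedIn H g⁻¹ := fun x hx => by
  conv_lhs => rw [← hg x hx]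
  exact HomeoPair.inv_apply_self g x

theorem SupportedIn.mem {H : Set E} {g : HomeoPair F} (hg : SupportedIn H g) {x : E}
    (hx : x ∈ H) : g.1 x ∈ H := by
  by_contra hn
  have := hg.inv _ hn
  rw [HomeoPair.inv_apply_self] at this
  exact hn (this ▸ hx)

theorem SupportedIn.conj {H H' : Set E} {g a : HomeoPair F} (hg : SupportedIn H g)
    (ha : ∀ x, x ∈ H → a.1 x ∈ H') : SupportedIn H' (a * g * a⁻¹) := fun x hx => by
  rw [HomeoPair.mul_apply, HomeoPair.mul_apply, hg, HomeoPair.apply_inv_self]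
  intro hxH
  have := ha _ hxH
  rw [HomeoPair.apply_inv_self] at this
  exact hx this

theorem SupportedIn.commute {H K : Set E} (hHK : Disjoint H K) {g k : HomeoPair F}
    (hg : SupportedIn H g) (hk : SupportedIn K k) : Commute g k := by
  refine HomeoPair.ext fun x => ?_
  rw [HomeoPair.mul_apply, HomeoPair.mul_apply]
  have hd := Set.disjoint_left.1 hHK
  by_cases hx : x ∈ H
  · rw [hk x (hd hx), hk _ (hd (hg.mem hx))]
  · rw [hg x hx]
    by_cases hx' : x ∈ K
    · rw [hg _ fun h => hd h (hk.mem hx')]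
    · rw [hk x hx', hg x hx]

/-- A homeomorphism that shifts a bi-infinite sequence of disjoint sets is a translation. -/
theorem isHTranslation_of_shift {K : ℤ → Set E} (hK : Pairwise fun m n => Disjoint (K m) (K n))
    (hH : IsHalfSpace F (K 0)) {φ : HomeoPair F} (hφ : ∀ n, φ.1 '' K n = K (n + 1)) :
    IsHTranslation F (K 0) φ := by
  have key : ∀ n : ℤ, ((φ ^ n : HomeoPair F) : E ≃ₜ E) '' K 0 = K n := by
    intro n
    induction n using Int.induction_on with
    | zero => exact Set.image_id _
    | succ n ih =>
      rw [add_comm, zpow_one_add, add_comm, ← hφ, ← ih, ← Set.image_comp]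
      rfl
    | pred n ih =>
      have h1 : φ ^ (-(n : ℤ)) = φ * φ ^ (-(n : ℤ) - 1) := by
        rw [← zpow_one_add]; congr 1; ring
      have h2 := hφ (-(n : ℤ) - 1)
      rw [sub_add_cancel, ← ih, h1] at h2
      refine φ.1.injective.image_injective (Eq.symm (h2.trans ?_))
      rw [← Set.image_comp]
      rfl
  refine ⟨hH, fun m n hmn => ?_⟩
  beta_reduce
  rw [key, key]
  exact hK hmn

theorem IsHTranslation.inv {H : Set E} {φ : HomeoPair F} (h : IsHTranslation F H φ) :
    IsHTranslation F H φ⁻¹ := by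
  refine ⟨h.1, fun m n hmn => ?_⟩
  simp only [inv_zpow']
  exact h.2 (neg_injective.ne hmn)

theorem continuous_wreath (σ : ℤ → ℤ) (k : ℤ → HomeoPair F) :
    Continuous fun z : ℤ × E => (σ z.1, (k z.1).1 z.2) := by
  rw [continuous_prod_of_discrete_left]
  intro n
  change Continuous fun x => (σ n, (k n).1 x)
  exact Continuous.prodMk continuous_const (k n).1.continuous

theorem IsHTranslation.disjoint_image {H : Set E} {φ : HomeoPair F} (h : IsHTranslation F H φ) :
    Disjoint H (φ.1 '' H) := by
  have hd : Disjoint (((φ ^ (0 : ℤ) : HomeoPair F) : E ≃ₜ E) '' H)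
      (((φ ^ (1 : ℤ) : HomeoPair F) : E ≃ₜ E) '' H) := h.2 zero_ne_one
  rwa [zpow_zero, zpow_one, show ((1 : HomeoPair F) : E ≃ₜ E) '' H = H from Set.image_id H] at hd

/-- The homeomorphism `(n, x) ↦ (σ n, k n x)` of `ℤ × E`. -/
def wreath (σ : Equiv.Perm ℤ) (k : ℤ → HomeoPair F) :
    HomeoPair (Prod.snd ⁻¹' F : Set (ℤ × E)) :=
  ⟨{ toFun := fun z => (σ z.1, (k z.1).1 z.2)
     invFun := fun z => (σ.symm z.1, (k (σ.symm z.1))⁻¹.1 z.2)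
     left_inv := fun z => by simp
     right_inv := fun z => by simp
     continuous_toFun := continuous_wreath σ k
     continuous_invFun := continuous_wreath σ.symm fun n => (k (σ.symm n))⁻¹ },
    mem_homeoPair_iff.2 fun z => HomeoPair.mem_iff (k z.1) z.2⟩

theorem wreath_mul (σ τ : Equiv.Perm ℤ) (k l : ℤ → HomeoPair F) :
    wreath σ k * wreath τ l = wreath (σ * τ) fun n => k (τ n) * l n :=
  HomeoPair.ext fun _ => rfl

end Group

/-! ### Extending homeomorphisms along open embeddings -/

section Extend

variable {E : Type*} [TopologicalSpace E] {F : Set E} [CompactSpace E] [T2Space E]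
  {X : Type*} [TopologicalSpace X]

/-- A homeomorphism of an open subspace, extended by the identity, stays continuous if the
subspace has at most one boundary point `p`: it permutes the compact sets whose complements are
the traces of the neighbourhoods of `p`. -/
theorem continuous_viaEmbedding {h : X → E} (ho : Topology.IsOpenEmbedding h) {p : E}
    (hp : closure (Set.range h) ⊆ insert p (Set.range h)) (θ : X ≃ₜ X) :
    Continuous (Equiv.Perm.viaEmbedding θ.toEquiv ⟨h, ho.injective⟩) := by
  set T := Equiv.Perm.viaEmbedding θ.toEquiv ⟨h, ho.injective⟩ with hT
  have hTh : ∀ x, T (h x) = h (θ x) := Equiv.Perm.viaEmbedding_apply θ.toEquiv ⟨h, ho.injective⟩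
  have hTn : ∀ y, y ∉ Set.range h → T y = y :=
    Equiv.Perm.viaEmbedding_apply_of_notMem θ.toEquiv ⟨h, ho.injective⟩
  rw [continuous_iff_continuousAt]
  intro y
  by_cases hy : y ∈ Set.range h
  · obtain ⟨x, rfl⟩ := hy
    rw [← ho.continuousAt_iff]
    have : ⇑T ∘ h = h ∘ θ := funext hTh
    rw [this]
    exact (ho.continuous.comp θ.continuous).continuousAt
  by_cases hyc : y ∈ closure (Set.range h)
  · obtain rfl : y = p := (hp hyc).resolve_right hy
    rw [ContinuousAt, hTn y hy, (nhds_basis_opens y).tendsto_right_iff]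
    rintro U ⟨hyU, hU⟩
    have hsub : closure (Set.range h) \ U ⊆ Set.range h := by
      rintro z ⟨hz, hzU⟩
      exact (hp hz).resolve_left fun h => hzU (h ▸ hyU)
    have hK : IsCompact (closure (Set.range h) \ U) := (isClosed_closure.sdiff hU).isCompact
    have hK' : IsCompact (h '' (θ ⁻¹' (h ⁻¹' (closure (Set.range h) \ U)))) :=
      (θ.isCompact_preimage.2 ((ho.isInducing.isCompact_preimage_iff hsub).2 hK)).image
        ho.continuous
    have hyK' : y ∉ h '' (θ ⁻¹' (h ⁻¹' (closure (Set.range h) \ U))) := by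
      rintro ⟨x, -, rfl⟩
      exact hy ⟨x, rfl⟩
    filter_upwards [hK'.isClosed.isOpen_compl.mem_nhds hyK', hU.mem_nhds hyU] with z hz hzU
    by_cases hzr : z ∈ Set.range h
    · obtain ⟨x, rfl⟩ := hzr
      rw [hTh]
      by_contra hn
      exact hz ⟨x, ⟨subset_closure ⟨_, rfl⟩, hn⟩, rfl⟩
    · rwa [hTn z hzr]
  · refine (continuousAt_id (x := y)).congr ?_
    filter_upwards [isClosed_closure.isOpen_compl.mem_nhds hyc] with z hz
    exact (hTn z fun h => hz (subset_closure h)).symm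

/-- An open embedding `h` of the pair `(X, F')` in `(E, F)` whose range has at most one boundary
point `p`. -/
structure IsChart (F : Set E) (F' : Set X) (p : E) (h : X → E) : Prop where
  isOpenEmbedding : Topology.IsOpenEmbedding h
  closure_range_subset : closure (Set.range h) ⊆ insert p (Set.range h)
  mem_iff : ∀ x, h x ∈ F ↔ x ∈ F'

theorem IsCopyMap.isChart {f : E → E} (hf : IsCopyMap F f) (p : E) : IsChart F F p f :=
  ⟨hf.1, (hf.1.continuous.isClosedMap.isClosed_range.closure_eq.le).trans
    (Set.subset_insert _ _), hf.2⟩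

variable {F' : Set X} {p : E} {h : X → E}

/-- Extension by the identity of the homeomorphisms of a pair `(X, F')` along a chart. -/
noncomputable def extendHom (hh : IsChart F F' p h) : HomeoPair F' →* HomeoPair F :=
  MonoidHom.mk' (fun θ =>
    ⟨{ toEquiv := Equiv.Perm.viaEmbeddingHom ⟨h, hh.1.injective⟩ θ.1.toEquiv
       continuous_toFun := continuous_viaEmbedding hh.1 hh.2 θ.1
       continuous_invFun := by
        change Continuous
          ⇑(Equiv.Perm.viaEmbeddingHom ⟨h, hh.1.injective⟩ (θ.1.toEquiv : Equiv.Perm X))⁻¹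
        rw [← map_inv]
        exact continuous_viaEmbedding hh.1 hh.2 θ.1.symm },
      mem_homeoPair_iff.2 fun x => by
        change Equiv.Perm.viaEmbedding θ.1.toEquiv ⟨h, hh.1.injective⟩ x ∈ F ↔ x ∈ F
        by_cases hx : x ∈ Set.range h
        · obtain ⟨x, rfl⟩ := hx
          have := Equiv.Perm.viaEmbedding_apply θ.1.toEquiv ⟨h, hh.1.injective⟩ x
          change Equiv.Perm.viaEmbedding θ.1.toEquiv ⟨h, hh.1.injective⟩ (h x) = h (θ.1 x) at this
          rw [this, hh.3, hh.3]
          exact HomeoPair.mem_iff θ x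
        · rw [Equiv.Perm.viaEmbedding_apply_of_notMem _ _ _ hx]⟩)
    fun θ η => Subtype.ext (Homeomorph.ext fun x =>
      Equiv.congr_fun (map_mul (Equiv.Perm.viaEmbeddingHom ⟨h, hh.1.injective⟩)
        θ.1.toEquiv η.1.toEquiv) x)

theorem extendHom_apply (hh : IsChart F F' p h) (θ : HomeoPair F') (x : X) :
    (extendHom hh θ).1 (h x) = h (θ.1 x) :=
  Equiv.Perm.viaEmbedding_apply θ.1.toEquiv ⟨h, hh.1.injective⟩ x

theorem extendHom_apply_of_notMem (hh : IsChart F F' p h) (θ : HomeoPair F') {y : E}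
    (hy : y ∉ Set.range h) : (extendHom hh θ).1 y = y :=
  Equiv.Perm.viaEmbedding_apply_of_notMem θ.1.toEquiv ⟨h, hh.1.injective⟩ y hy

theorem SupportedIn.exists_extendHom_eq (hh : IsChart F F' p h) {g : HomeoPair F}
    (hg : SupportedIn (Set.range h) g) : ∃ θ : HomeoPair F', extendHom hh θ = g := by
  have h1 : ∀ x, ∃ z, h z = g.1 (h x) := fun x => hg.mem ⟨x, rfl⟩
  have h2 : ∀ x, ∃ z, h z = g⁻¹.1 (h x) := fun x => hg.inv.mem ⟨x, rfl⟩
  choose u hu using h1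
  choose v hv using h2
  let θ : X ≃ₜ X :=
    { toFun := u
      invFun := v
      left_inv := fun x => hh.1.injective (by rw [hv, hu, HomeoPair.inv_apply_self])
      right_inv := fun x => hh.1.injective (by rw [hu, hv, HomeoPair.apply_inv_self])
      continuous_toFun := by
        rw [hh.1.isInducing.continuous_iff, show h ∘ u = g.1 ∘ h from funext hu]
        exact g.1.continuous.comp hh.1.continuous
      continuous_invFun := by
        rw [hh.1.isInducing.continuous_iff, show h ∘ v = g⁻¹.1 ∘ h from funext hv]
        exact g⁻¹.1.continuous.comp hh.1.continuous }
  have hθ : ∀ x, h (θ x) = g.1 (h x) := hu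
  have hmem : θ ∈ HomeoPair F' := mem_homeoPair_iff.2 fun x => by
    rw [← hh.3, ← hh.3, hθ, HomeoPair.mem_iff]
  refine ⟨⟨θ, hmem⟩, HomeoPair.ext fun y => ?_⟩
  by_cases hy : y ∈ Set.range h
  · obtain ⟨x, rfl⟩ := hy
    rw [extendHom_apply, hθ]
  · rw [extendHom_apply_of_notMem hh _ hy, hg y hy]

end Extend

/-! ### Commutators, translations and involutions for elements supported in a half-space -/

section HalfSpaceSupport

variable {E : Type*} [TopologicalSpace E] {F : Set E} [CompactSpace E] [T2Space E]
  {p : E} {h : ℤ × E → E}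

theorem IsChart.isHTranslation (hh : IsChart F (Prod.snd ⁻¹' F : Set (ℤ × E)) p h)
    (hH : IsHalfSpace F (Set.range fun x => h (0, x))) (k : ℤ → HomeoPair F) :
    IsHTranslation F (Set.range fun x => h (0, x))
      (extendHom hh (wreath (Equiv.addRight 1) k)) := by
  refine isHTranslation_of_shift (K := fun n => Set.range fun x => h (n, x))
    (fun m n hmn => ?_) hH fun n => ?_
  · refine Set.disjoint_left.2 ?_
    rintro _ ⟨x, rfl⟩ ⟨y, hy⟩
    exact hmn (congrArg Prod.fst (hh.1.injective hy)).symm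
  · rw [← Set.range_comp]
    have : (extendHom hh (wreath (Equiv.addRight 1) k)).1 ∘ (fun x => h (n, x)) =
        (fun x => h (n + 1, x)) ∘ (k n).1 := funext fun x => extendHom_apply hh _ _
    rw [this, (k n).1.surjective.range_comp]

theorem IsChart.isInvolution (hh : IsChart F (Prod.snd ⁻¹' F : Set (ℤ × E)) p h) [Nonempty E]
    {σ : Equiv.Perm ℤ} (hσ : σ * σ = 1) {n : ℤ} (hn : σ n ≠ n) :
    IsInvolution (extendHom hh (wreath σ 1)) := by
  refine orderOf_eq_prime_iff.2 ⟨?_, fun h1 => ?_⟩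
  · rw [pow_two, ← map_mul, wreath_mul, hσ]
    exact map_one (extendHom hh)
  · obtain ⟨x⟩ := ‹Nonempty E›
    have h2 := extendHom_apply hh (wreath σ 1) (n, x)
    rw [h1] at h2
    exact hn (congrArg Prod.fst (hh.1.injective h2)).symm

theorem neg_mul_neg_perm : (Equiv.neg ℤ) * (Equiv.neg ℤ) = 1 := by
  ext n; simp

theorem subLeft_mul_subLeft : (Equiv.subLeft (1 : ℤ)) * (Equiv.subLeft (1 : ℤ)) = 1 := by
  ext n; simp

theorem subLeft_mul_neg : (Equiv.subLeft (1 : ℤ)) * (Equiv.neg ℤ) = Equiv.addRight 1 := by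
  ext n; simp [add_comm]

variable [TotallyDisconnectedSpace E] [SecondCountableTopology E]

/-- Every half-space is the zeroth term of a sequence of disjoint copies of `(E, F)`, indexed by
`ℤ`, that converges to a single point in both directions. -/
theorem IsUniformlySelfSimilar.exists_isChart (hF : IsClosed F) (hE : IsUniformlySelfSimilar F)
    {H : Set E} (hH : IsHalfSpace F H) : ∃ (p : E) (h : ℤ × E → E),
      IsChart F (Prod.snd ⁻¹' F : Set (ℤ × E)) p h ∧ Set.range (fun x => h (0, x)) = H := by
  classical
  obtain ⟨hHc, hHM, p, hpH, hp⟩ := isHalfSpace_iff.1 hH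
  obtain ⟨K, hKc, hKM, hKH, hKd, -, hKp⟩ := hE.exists_clopen_seq hHc.compl hpH hp
  let L : ℤ → Set E := fun n => if n = 0 then H else K (Equiv.intEquivNat n)
  have hL0 : L 0 = H := if_pos rfl
  have hLn : ∀ n, n ≠ 0 → L n = K (Equiv.intEquivNat n) := fun n hn => if_neg hn
  have hLc : ∀ n, IsClopen (L n) ∧ (L n ∩ maximalEnds F).Nonempty := by
    intro n
    by_cases hn : n = 0
    · rw [hn, hL0]; exact ⟨hHc, hHM⟩
    · rw [hLn n hn]; exact ⟨hKc _, hKM _⟩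
  have hHK : ∀ n, Disjoint H (K n) := fun n =>
    Set.disjoint_left.2 fun x hx hx' => hKH n hx' hx
  have hLd : ∀ m n, m ≠ n → Disjoint (L m) (L n) := by
    intro m n hmn
    by_cases hm : m = 0
    · rw [hm, hL0, hLn n fun hn => hmn (hm.trans hn.symm)]; exact hHK _
    · by_cases hn : n = 0
      · rw [hn, hL0, hLn m hm]; exact (hHK _).symm
      · rw [hLn m hm, hLn n hn]; exact hKd (Equiv.intEquivNat.injective.ne hmn)
  have hfin : ∀ W, IsOpen W → p ∈ W → {n | ¬ L n ⊆ W}.Finite := by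
    intro W hW hpW
    obtain ⟨N, hN⟩ := hKp W hW hpW
    refine (((Set.finite_lt_nat N).preimage Equiv.intEquivNat.injective.injOn).insert 0).subset ?_
    intro n hn
    by_cases h0 : n = 0
    · exact Or.inl h0
    · refine Or.inr ((not_le (α := ℕ)).1 fun hle => hn ?_)
      rw [hLn n h0]
      exact hN _ hle
  have hf : ∀ n, ∃ f, IsCopyMap F f ∧ Set.range f = L n := fun n =>
    hE.exists_isCopyMap_range_eq hF (hLc n).1 (hLc n).2
  choose f hf hfL using hf
  let h : ℤ × E → E := fun z => f z.1 z.2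
  have hmem : ∀ z, h z ∈ L z.1 := fun z => hfL z.1 ▸ ⟨z.2, rfl⟩
  have hinj : Function.Injective h := by
    rintro ⟨m, x⟩ ⟨n, y⟩ hxy
    obtain rfl : m = n := by
      by_contra hmn
      have hy := hmem (n, y)
      rw [← hxy] at hy
      exact Set.disjoint_left.1 (hLd m n hmn) (hmem (m, x)) hy
    exact congrArg (Prod.mk m) ((hf m).1.injective hxy)
  have hcont : Continuous h := continuous_prod_of_discrete_left.2 fun n => (hf n).1.continuous
  have hopen : IsOpenMap h := by
    intro U hU
    have : h '' U = ⋃ n, f n '' ((fun x => (n, x)) ⁻¹' U) := by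
      ext y
      simp [h]
    rw [this]
    exact isOpen_iUnion fun n =>
      (hf n).1.isOpenMap _ (hU.preimage (Continuous.prodMk_right n))
  refine ⟨p, h, ⟨.of_continuous_injective_isOpenMap hcont hinj hopen, fun x hx => ?_,
    fun z => (hf z.1).mem_iff z.2⟩, (hfL 0).trans hL0⟩
  by_contra hn
  rw [Set.mem_insert_iff, not_or] at hn
  obtain ⟨V, W, hV, hW, hxV, hpW, hVW⟩ := t2_separation hn.1
  have hS := hfin W hW hpW
  have hopen' : IsOpen (V \ ⋃ n ∈ {n | ¬ L n ⊆ W}, L n) :=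
    hV.sdiff (hS.isClosed_biUnion fun n _ => (hLc n).1.1)
  obtain ⟨_, ⟨hzV, hz⟩, z, rfl⟩ := mem_closure_iff.1 hx _ hopen' ⟨hxV, by
    simp only [Set.mem_iUnion, not_exists]
    intro n _ hxn
    rw [← hfL n] at hxn
    obtain ⟨y, rfl⟩ := hxn
    exact hn.2 ⟨(n, y), rfl⟩⟩
  simp only [Set.mem_iUnion, not_exists] at hz
  refine hz z.1 (fun hLW => ?_) (hmem z)
  exact Set.disjoint_left.1 hVW hzV (hLW (hmem z))

/-- With `φ` the shift of the copies and `a` acting as `g` on all copies of non-negative index,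
`g` is the commutator of `a` and `φ`; the shift and its modification `g φ` are translations, and
the shift is the product of two reflections of `ℤ`. -/
theorem SupportedIn.exists_factorizations (hF : IsClosed F) (hE : IsUniformlySelfSimilar F)
    {H : Set E} (hH : IsHalfSpace F H) {g : HomeoPair F} (hg : SupportedIn H g) :
    ∃ a φ σ τ : HomeoPair F, g = a * φ * a⁻¹ * φ⁻¹ ∧ φ = σ * τ ∧ IsInvolution σ ∧
      IsInvolution τ ∧ IsHTranslation F H φ ∧ IsHTranslation F H (g * φ) := by
  obtain ⟨p, h, hh, rfl⟩ := hE.exists_isChart hF hH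
  have : Nonempty E := ⟨p⟩
  have hchart : IsChart F F p fun x => h (0, x) :=
    IsCopyMap.isChart ⟨hh.1.comp (.of_continuous_injective_isOpenMap (Continuous.prodMk_right 0)
      (Prod.mk_right_injective 0) fun U hU =>
        Set.singleton_prod ▸ (isOpen_discrete {(0 : ℤ)}).prod hU), fun x => hh.3 (0, x)⟩ p
  obtain ⟨θ, hθ⟩ := hg.exists_extendHom_eq hchart
  have hgw : g = extendHom hh (wreath 1 (Pi.mulSingle 0 θ)) := by
    refine HomeoPair.ext fun y => ?_
    by_cases hy : y ∈ Set.range h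
    · obtain ⟨⟨n, x⟩, rfl⟩ := hy
      rw [extendHom_apply]
      by_cases hn : n = 0
      · subst hn
        rw [← hθ, extendHom_apply hchart]
        simp [wreath]
      · rw [hg]
        · simp [wreath, hn]
        · rintro ⟨x', hx'⟩
          exact hn (congrArg Prod.fst (hh.1.injective hx')).symm
    · rw [extendHom_apply_of_notMem hh _ hy, hg]
      rintro ⟨x', hx'⟩
      exact hy ⟨_, hx'⟩
  let s : Equiv.Perm ℤ := Equiv.addRight 1
  let k : ℤ → HomeoPair F := fun n => if 0 ≤ n then θ else 1
  have hφ : extendHom hh (wreath s 1) =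
      extendHom hh (wreath (Equiv.subLeft 1) 1) * extendHom hh (wreath (Equiv.neg ℤ) 1) := by
    rw [← map_mul, wreath_mul, subLeft_mul_neg]
    rfl
  have hgφ : g * extendHom hh (wreath s 1) =
      extendHom hh (wreath s fun n => Pi.mulSingle (M := fun _ => HomeoPair F) 0 θ (s n)) := by
    rw [hgw, ← map_mul, wreath_mul, one_mul]
    simp
  refine ⟨extendHom hh (wreath 1 k), extendHom hh (wreath s 1), _, _, ?_, hφ,
    hh.isInvolution subLeft_mul_subLeft (n := 0) (by simp),
    hh.isInvolution neg_mul_neg_perm (n := 1) (by simp), hh.isHTranslation hH 1, ?_⟩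
  · rw [eq_mul_inv_iff_mul_eq, eq_mul_inv_iff_mul_eq, hgφ, ← map_mul, ← map_mul, wreath_mul,
      wreath_mul]
    congr 2
    funext n
    have hs : s n = n + 1 := rfl
    rcases lt_trichotomy n (-1) with hn | rfl | hn
    · simp [k, hs, show ¬ 0 ≤ n by omega, show ¬ 0 ≤ n + 1 by omega,
        show n + 1 ≠ 0 by omega]
    · simp [k, hs]
    · simp [k, hs, show 0 ≤ n by omega, show 0 ≤ n + 1 by omega,
        show n + 1 ≠ 0 by omega]
  · rw [hgφ]
    exact hh.isHTranslation hH _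

end HalfSpaceSupport

/-! ### Fragmentation -/

section Fragmentation

variable {E : Type*} [TopologicalSpace E] {F : Set E}

/-- If a homeomorphism `f` moves a clopen set `H` off itself, the map that is `f` on `H`, its
inverse on `f '' H` and the identity elsewhere is a homeomorphism. -/
theorem HomeoPair.exists_swap (f : HomeoPair F) {H : Set E} (hH : IsClopen H)
    (hd : Disjoint H (f.1 '' H)) :
    ∃ g : HomeoPair F, SupportedIn (H ∪ f.1 '' H) g ∧ ∀ x ∈ H, g.1 x = f.1 x := by
  classical
  let u : E → E := H.piecewise f.1 ((f.1 '' H).piecewise f.1.symm id)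
  have hH' : IsClopen (f.1 '' H) := ⟨f.1.isClosedMap _ hH.1, f.1.isOpenMap _ hH.2⟩
  have hu1 : ∀ x ∈ H, u x = f.1 x := fun x hx => Set.piecewise_eq_of_mem _ _ _ hx
  have hu2 : ∀ x ∈ H, u (f.1 x) = x := fun x hx => by
    have h1 : f.1 x ∈ f.1 '' H := ⟨x, hx, rfl⟩
    simp only [u]
    rw [Set.piecewise_eq_of_notMem _ _ _ (Set.disjoint_right.1 hd h1),
      Set.piecewise_eq_of_mem _ _ _ h1, Homeomorph.symm_apply_apply]
  have hu3 : ∀ x, x ∉ H → x ∉ f.1 '' H → u x = x := fun x hx hx' => by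
    simp only [u]
    rw [Set.piecewise_eq_of_notMem _ _ _ hx, Set.piecewise_eq_of_notMem _ _ _ hx', id]
  have hcases : ∀ x, x ∈ H ∨ (∃ z ∈ H, f.1 z = x) ∨ (x ∉ H ∧ x ∉ f.1 '' H) := fun x => by
    by_cases h1 : x ∈ H
    · exact Or.inl h1
    · by_cases h2 : x ∈ f.1 '' H
      · exact Or.inr (Or.inl h2)
      · exact Or.inr (Or.inr ⟨h1, h2⟩)
  have hinv : Function.Involutive u := fun x => by
    rcases hcases x with hx | ⟨z, hz, rfl⟩ | ⟨h1, h2⟩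
    · rw [hu1 x hx, hu2 x hx]
    · rw [hu2 z hz, hu1 z hz]
    · rw [hu3 x h1 h2, hu3 x h1 h2]
  have hcont : Continuous u :=
    f.1.continuous.piecewise (by simp [hH.frontier_eq])
      (f.1.symm.continuous.piecewise (by simp [hH'.frontier_eq]) continuous_id)
  refine ⟨⟨⟨hinv.toPerm, hcont, hcont⟩, mem_homeoPair_iff.2 fun x => ?_⟩, fun x hx => ?_, hu1⟩
  · change u x ∈ F ↔ x ∈ F
    rcases hcases x with hx | ⟨z, hz, rfl⟩ | ⟨h1, h2⟩
    · rw [hu1 x hx, HomeoPair.mem_iff f]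
    · rw [hu2 z hz, HomeoPair.mem_iff f]
    · rw [hu3 x h1 h2]
  · rw [Set.mem_union, not_or] at hx
    exact hu3 x hx.1 hx.2

variable [CompactSpace E] [T2Space E] [TotallyDisconnectedSpace E]

/-- An element that moves a maximal end moves a small half-space `H` off itself; it agrees on `H`
with an element supported in a half-space, so it is a product of two elements supported in
half-spaces. -/
theorem IsUniformlySelfSimilar.exists_fragmentation_of_ne (hE : IsUniformlySelfSimilar F)
    (f : HomeoPair F) {m : E} (hm : m ∈ maximalEnds F) (hfm : f.1 m ≠ m) :
    ∃ g₁ g₂ : HomeoPair F, (∃ H, IsHalfSpace F H ∧ SupportedIn H g₁) ∧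
      (∃ H, IsHalfSpace F H ∧ SupportedIn H g₂) ∧ f = g₁ * g₂ := by
  classical
  -- a third maximal end keeps the complement of the support non-trivial
  obtain ⟨c, ⟨-, hc⟩, hcm⟩ :=
    (hE.infinite_inter isOpen_univ (Set.mem_univ m) hm).exists_notMem_finset {m, f.1 m}
  have hcm1 : m ≠ c := fun h => hcm (by simp [h])
  have hcm2 : f.1 m ≠ c := fun h => hcm (by simp [h])
  obtain ⟨A, hA, hmA, hcA⟩ := exists_isClopen_of_totally_separated hcm1
  obtain ⟨B, hB, hmB, hcB⟩ := exists_isClopen_of_totally_separated hcm2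
  obtain ⟨C, hC, hmC, hfC⟩ := exists_isClopen_of_totally_separated hfm.symm
  let H := A ∩ C ∩ f.1 ⁻¹' (B \ C)
  have hH : IsClopen H := (hA.inter hC).inter ((hB.diff hC).preimage f.1.continuous)
  have hmH : m ∈ H := ⟨⟨hmA, hmC⟩, hmB, hfC⟩
  have hcH : c ∉ H := fun h => hcA h.1.1
  have hd : Disjoint H (f.1 '' H) := by
    refine Set.disjoint_left.2 ?_
    rintro _ hx ⟨z, hz, rfl⟩
    exact hz.2.2 hx.1.2
  have hH' : IsClopen (f.1 '' H) := ⟨f.1.isClosedMap _ hH.1, f.1.isOpenMap _ hH.2⟩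
  obtain ⟨g, hg, hgf⟩ := HomeoPair.exists_swap f hH hd
  refine ⟨g, g⁻¹ * f, ⟨H ∪ f.1 '' H, isHalfSpace_iff.2 ⟨hH.union hH', ⟨m, Or.inl hmH, hm⟩, c,
    ?_, hc⟩, hg⟩, ⟨Hᶜ, IsHalfSpace.compl (isHalfSpace_iff.2 ⟨hH, ⟨m, hmH, hm⟩, c, hcH, hc⟩),
      fun x hx => ?_⟩, (mul_inv_cancel_left g f).symm⟩
  · rintro (h | ⟨z, hz, hzc⟩)
    · exact hcH h
    · exact hcB (hzc ▸ hz.2.1)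
  · rw [HomeoPair.mul_apply, ← hgf x (not_not.1 hx), HomeoPair.inv_apply_self]

variable [SecondCountableTopology E]

theorem IsUniformlySelfSimilar.exists_supportedIn_ne (hF : IsClosed F)
    (hE : IsUniformlySelfSimilar F) : ∃ (g : HomeoPair F) (H : Set E) (m : E),
      IsHalfSpace F H ∧ SupportedIn H g ∧ m ∈ maximalEnds F ∧ g.1 m ≠ m := by
  obtain ⟨H, hH⟩ := hE.exists_isHalfSpace
  obtain ⟨-, φ, -, -, -, -, -, -, hφ, -⟩ :=
    SupportedIn.exists_factorizations hF hE hH (g := 1) fun x _ => rfl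
  obtain ⟨m, hmH, hm⟩ := hH.2.1
  have hφm : φ.1 m ≠ m := fun h => Set.disjoint_left.1 hφ.disjoint_image hmH ⟨m, hmH, h⟩
  obtain ⟨g₁, g₂, ⟨H₁, hH₁, hg₁⟩, ⟨H₂, hH₂, hg₂⟩, hg⟩ :=
    hE.exists_fragmentation_of_ne φ hm hφm
  by_cases h2 : g₂.1 m = m
  · refine ⟨g₁, H₁, m, hH₁, hg₁, hm, fun h1 => hφm ?_⟩
    rw [hg, HomeoPair.mul_apply, h2, h1]
  · exact ⟨g₂, H₂, m, hH₂, hg₂, hm, h2⟩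

/-- Every element is a product of three elements supported in half-spaces: an element that fixes
all maximal ends is first multiplied by one that does not. -/
theorem IsUniformlySelfSimilar.exists_fragmentation (hF : IsClosed F)
    (hE : IsUniformlySelfSimilar F) (f : HomeoPair F) :
    ∃ g₁ g₂ g₃ : HomeoPair F, (∃ H, IsHalfSpace F H ∧ SupportedIn H g₁) ∧
      (∃ H, IsHalfSpace F H ∧ SupportedIn H g₂) ∧ (∃ H, IsHalfSpace F H ∧ SupportedIn H g₃) ∧
      f = g₁ * g₂ * g₃ := by
  obtain ⟨g, H, m, hH, hg, hm, hgm⟩ := hE.exists_supportedIn_ne hF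
  by_cases hfm : f.1 m = m
  · obtain ⟨g₁, g₂, h₁, h₂, hgf⟩ := hE.exists_fragmentation_of_ne (g * f) hm (by
      rwa [HomeoPair.mul_apply, hfm])
    exact ⟨g⁻¹, g₁, g₂, ⟨H, hH, hg.inv⟩, h₁, h₂, by rw [mul_assoc, ← hgf]; group⟩
  · obtain ⟨g₁, g₂, h₁, h₂, hf⟩ := hE.exists_fragmentation_of_ne f hm hfm
    exact ⟨1, g₁, g₂, ⟨H, hH, fun x _ => rfl⟩, h₁, h₂, by rw [one_mul, hf]⟩

end Fragmentation

end EndsSpace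

/-! ### Products of bounded length -/

section Products

variable {G : Type*} [Group G] {P : G → Prop} {g h : G} {m n : ℕ}

theorem IsProductOfAtMost.of_pred (h : P g) : IsProductOfAtMost 1 P g :=
  ⟨[g], le_rfl, by simpa using h, by simp⟩

theorem IsProductOfAtMost.mul (hg : IsProductOfAtMost m P g) (hh : IsProductOfAtMost n P h) :
    IsProductOfAtMost (m + n) P (g * h) := by
  obtain ⟨l, hl, hlP, rfl⟩ := hg
  obtain ⟨k, hk, hkP, rfl⟩ := hh
  refine ⟨l ++ k, by simpa using add_le_add hl hk, fun x hx => ?_, by simp⟩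
  rcases List.mem_append.1 hx with h | h
  exacts [hlP x h, hkP x h]

theorem IsInvolution.inv_eq (h : IsInvolution g) : g⁻¹ = g := by
  have := pow_orderOf_eq_one g
  rw [show orderOf g = 2 from h, pow_two] at this
  exact inv_eq_of_mul_eq_one_left this

theorem IsInvolution.conj (h : IsInvolution g) (a : G) : IsInvolution (a * g * a⁻¹) :=
  (MulEquiv.orderOf_eq (MulAut.conj a) g).trans h

end Products

namespace EndsSpace

/-! ### Normal generation -/

section NormalGeneration

variable {E : Type*} [TopologicalSpace E] {F : Set E} [CompactSpace E] [T2Space E]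
  [TotallyDisconnectedSpace E] [SecondCountableTopology E]

theorem IsUniformlySelfSimilar.isProductOfAtMost (hF : IsClosed F)
    (hE : IsUniformlySelfSimilar F) {P : HomeoPair F → Prop} {n : ℕ}
    (hP : ∀ (g : HomeoPair F) (H : Set E), IsHalfSpace F H → SupportedIn H g →
      IsProductOfAtMost n P g) (g : HomeoPair F) : IsProductOfAtMost (n + n + n) P g := by
  obtain ⟨g₁, g₂, g₃, ⟨H₁, hH₁, h₁⟩, ⟨H₂, hH₂, h₂⟩, ⟨H₃, hH₃, h₃⟩, rfl⟩ :=
    hE.exists_fragmentation hF g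
  exact ((hP _ _ hH₁ h₁).mul (hP _ _ hH₂ h₂)).mul (hP _ _ hH₃ h₃)

theorem IsUniformlySelfSimilar.isProductOfAtMost_three_isCommutator (hF : IsClosed F)
    (hE : IsUniformlySelfSimilar F) (g : HomeoPair F) : IsProductOfAtMost 3 IsCommutator g := by
  refine hE.isProductOfAtMost (n := 1) hF (fun g H hH hg => ?_) g
  obtain ⟨a, φ, -, -, h, -⟩ := hg.exists_factorizations hF hE hH
  exact .of_pred ⟨a, φ, h.symm⟩

theorem IsUniformlySelfSimilar.isProductOfAtMost_six_isHTranslation (hF : IsClosed F)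
    (hE : IsUniformlySelfSimilar F) (g : HomeoPair F) :
    IsProductOfAtMost 6 (fun φ => ∃ H : Set E, IsHTranslation F H φ) g := by
  refine hE.isProductOfAtMost (n := 2) hF (fun g H hH hg => ?_) g
  obtain ⟨-, φ, -, -, -, -, -, -, hφ, hgφ⟩ := hg.exists_factorizations hF hE hH
  rw [← mul_inv_cancel_right g φ]
  exact IsProductOfAtMost.mul (m := 1) (n := 1) (.of_pred ⟨H, hgφ⟩) (.of_pred ⟨H, hφ.inv⟩)

theorem IsUniformlySelfSimilar.isProductOfAtMost_twelve_isInvolution (hF : IsClosed F)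
    (hE : IsUniformlySelfSimilar F) (g : HomeoPair F) : IsProductOfAtMost 12 IsInvolution g := by
  refine hE.isProductOfAtMost (n := 4) hF (fun g H hH hg => ?_) g
  obtain ⟨a, φ, σ, τ, h, rfl, hσ, hτ, -⟩ := hg.exists_factorizations hF hE hH
  have : g = a * σ * a⁻¹ * (a * τ * a⁻¹) * (τ * σ) := by
    nth_rewrite 2 [← hτ.inv_eq]
    nth_rewrite 2 [← hσ.inv_eq]
    rw [h]
    group
  rw [this]
  exact IsProductOfAtMost.mul (m := 2) (n := 2)
    (IsProductOfAtMost.mul (m := 1) (n := 1) (.of_pred (hσ.conj a)) (.of_pred (hτ.conj a)))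
    (IsProductOfAtMost.mul (m := 1) (n := 1) (.of_pred hτ) (.of_pred hσ))

/-- Any half-space is carried onto any other by an element of the group: both they and their
complements are copies of the whole pair. -/
theorem IsUniformlySelfSimilar.exists_homeoPair_mem_iff (hF : IsClosed F)
    (hE : IsUniformlySelfSimilar F) {H K : Set E} (hH : IsHalfSpace F H) (hK : IsHalfSpace F K) :
    ∃ a : HomeoPair F, ∀ x, a.1 x ∈ K ↔ x ∈ H := by
  have key : ∀ H, IsHalfSpace F H → ∃ s : E ⊕ E ≃ₜ E, ∀ x, s (.inl x) ∈ H ∧ s (.inr x) ∉ H ∧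
      (s (.inl x) ∈ F ↔ x ∈ F) ∧ (s (.inr x) ∈ F ↔ x ∈ F) := by
    intro H hH
    obtain ⟨hHc, hHM, hHM'⟩ := isHalfSpace_iff.1 hH
    obtain ⟨f, hf, hfH⟩ := hE.exists_isCopyMap_range_eq hF hHc hHM
    obtain ⟨g, hg, hgH⟩ := hE.exists_isCopyMap_range_eq hF hHc.compl hHM'
    have hf' : ∀ x, f x ∈ H := fun x => hfH ▸ ⟨x, rfl⟩
    have hg' : ∀ x, g x ∉ H := fun x => by
      have : g x ∈ Hᶜ := hgH ▸ ⟨x, rfl⟩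
      exact this
    have hbij : Function.Bijective (Sum.elim f g) := by
      refine ⟨hf.1.injective.sumElim hg.1.injective fun x y h => hg' y (h ▸ hf' x), fun y => ?_⟩
      by_cases hy : y ∈ H
      · rw [← hfH] at hy
        obtain ⟨x, rfl⟩ := hy
        exact ⟨.inl x, rfl⟩
      · have hy : y ∈ Hᶜ := hy
        rw [← hgH] at hy
        obtain ⟨x, rfl⟩ := hy
        exact ⟨.inr x, rfl⟩
    exact ⟨Continuous.homeoOfEquivCompactToT2 (f := Equiv.ofBijective _ hbij)
      (hf.1.continuous.sumElim hg.1.continuous),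
      fun x => ⟨hf' x, hg' x, hf.mem_iff x, hg.mem_iff x⟩⟩
  obtain ⟨s, hs⟩ := key H hH
  obtain ⟨t, ht⟩ := key K hK
  refine ⟨⟨s.symm.trans t, mem_homeoPair_iff.2 fun x => ?_⟩, fun x => ?_⟩ <;>
    obtain ⟨x | x, rfl⟩ := s.surjective x
  · simpa using (ht x).2.2.1.trans (hs x).2.2.1.symm
  · simpa using (ht x).2.2.2.trans (hs x).2.2.2.symm
  · simpa using iff_of_true (ht x).1 (hs x).1
  · simpa using iff_of_false (ht x).2.1 (hs x).2.1

/-- A normal subgroup containing an element `τ` that moves a half-space `H` off itself is the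
whole group. For `a`, `b` supported in `H`, the factor `τ a⁻¹ τ⁻¹` of `[a, τ]` commutes
with `b`, so `[a, b] = [[a, τ], b]`; since the group of elements supported in `H` is a copy of the
whole, perfect, group, the normal subgroup contains it, hence all elements supported in
half-spaces. -/
theorem IsUniformlySelfSimilar.eq_top_of_disjoint (hF : IsClosed F)
    (hE : IsUniformlySelfSimilar F) {N : Subgroup (HomeoPair F)} (hN : N.Normal)
    {τ : HomeoPair F} (hτ : τ ∈ N) {H : Set E} (hH : IsHalfSpace F H)
    (hd : Disjoint H (τ.1 '' H)) : N = ⊤ := by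
  have hperf : ⁅(⊤ : Subgroup (HomeoPair F)), (⊤ : Subgroup (HomeoPair F))⁆ = ⊤ := by
    refine eq_top_iff.2 fun g _ => ?_
    obtain ⟨l, -, hl, rfl⟩ := hE.isProductOfAtMost_three_isCommutator hF g
    refine Subgroup.list_prod_mem _ fun x hx => ?_
    obtain ⟨a, b, rfl⟩ := hl x hx
    exact Subgroup.commutator_mem_commutator trivial trivial
  have hcomm : ∀ a b : HomeoPair F, SupportedIn H a → SupportedIn H b →
      a * b * a⁻¹ * b⁻¹ ∈ N := by
    intro a b ha hb
    have hc : SupportedIn (τ.1 '' H) (τ * a⁻¹ * τ⁻¹) :=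
      ha.inv.conj fun x hx => ⟨x, hx, rfl⟩
    have hcb : Commute (τ * a⁻¹ * τ⁻¹) b := (hb.commute hd hc).symm
    have h1 : a * (τ * a⁻¹ * τ⁻¹) ∈ N := by
      rw [show a * (τ * a⁻¹ * τ⁻¹) = (a * τ * a⁻¹) * τ⁻¹ by group]
      exact N.mul_mem (hN.conj_mem τ hτ a) (N.inv_mem hτ)
    have h2 : a * b * a⁻¹ * b⁻¹ =
        a * (τ * a⁻¹ * τ⁻¹) * (b * (a * (τ * a⁻¹ * τ⁻¹))⁻¹ * b⁻¹) := by
      have : (τ * a⁻¹ * τ⁻¹) * b * (τ * a⁻¹ * τ⁻¹)⁻¹ = b := by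
        rw [hcb.eq, mul_inv_cancel_right]
      calc a * b * a⁻¹ * b⁻¹ = a * ((τ * a⁻¹ * τ⁻¹) * b * (τ * a⁻¹ * τ⁻¹)⁻¹) * a⁻¹ * b⁻¹ := by
            rw [this]
        _ = _ := by group
    rw [h2]
    exact N.mul_mem h1 (hN.conj_mem _ (N.inv_mem h1) b)
  have hHN : ∀ g : HomeoPair F, SupportedIn H g → g ∈ N := by
    intro g hg
    obtain ⟨hHc, ⟨p, hpH, hp⟩, -⟩ := isHalfSpace_iff.1 hH
    obtain ⟨f, hf, rfl⟩ := hE.exists_isCopyMap_range_eq hF hHc ⟨p, hpH, hp⟩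
    obtain ⟨θ, rfl⟩ := hg.exists_extendHom_eq (hf.isChart p)
    have hsupp : ∀ η, SupportedIn (Set.range f) (extendHom (hf.isChart p) η) :=
      fun η y hy => extendHom_apply_of_notMem _ _ hy
    have hmap : (⊤ : Subgroup (HomeoPair F)).map (extendHom (hf.isChart p)) ≤ N := by
      rw [← hperf, Subgroup.map_commutator, Subgroup.commutator_le]
      rintro _ ⟨a, -, rfl⟩ _ ⟨b, -, rfl⟩
      exact hcomm _ _ (hsupp a) (hsupp b)
    exact hmap ⟨θ, trivial, rfl⟩
  have hall : ∀ (g : HomeoPair F) (K : Set E), IsHalfSpace F K → SupportedIn K g → g ∈ N := by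
    intro g K hK hg
    obtain ⟨a, ha⟩ := hE.exists_homeoPair_mem_iff hF hK hH
    have := hN.conj_mem _ (hHN _ (hg.conj fun x hx => (ha x).2 hx)) a⁻¹
    rwa [show a⁻¹ * (a * g * a⁻¹) * a⁻¹⁻¹ = g by group] at this
  refine eq_top_iff.2 fun g _ => ?_
  obtain ⟨g₁, g₂, g₃, ⟨H₁, hH₁, h₁⟩, ⟨H₂, hH₂, h₂⟩, ⟨H₃, hH₃, h₃⟩, rfl⟩ :=
    hE.exists_fragmentation hF g
  exact N.mul_mem (N.mul_mem (hall _ _ hH₁ h₁) (hall _ _ hH₂ h₂)) (hall _ _ hH₃ h₃)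

theorem IsUniformlySelfSimilar.normalClosure_eq_top (hF : IsClosed F)
    (hE : IsUniformlySelfSimilar F) {τ : HomeoPair F} {H : Set E} (hH : IsHalfSpace F H)
    (hd : Disjoint H (τ.1 '' H)) : Subgroup.normalClosure {τ} = ⊤ :=
  hE.eq_top_of_disjoint hF Subgroup.normalClosure_normal
    (Subgroup.subset_normalClosure rfl) hH hd

/-- The reflection `n ↦ 1 - n` of a bi-infinite sequence of copies is an involution moving the
zeroth copy off itself. -/
theorem IsUniformlySelfSimilar.exists_isInvolution_disjoint (hF : IsClosed F)
    (hE : IsUniformlySelfSimilar F) {H : Set E} (hH : IsHalfSpace F H) :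
    ∃ τ : HomeoPair F, IsInvolution τ ∧ Disjoint H (τ.1 '' H) := by
  obtain ⟨p, h, hh, rfl⟩ := hE.exists_isChart hF hH
  have : Nonempty E := ⟨p⟩
  refine ⟨extendHom hh (wreath (Equiv.subLeft 1) 1),
    hh.isInvolution subLeft_mul_subLeft (n := 0) (by simp), Set.disjoint_left.2 ?_⟩
  rintro _ ⟨x, rfl⟩ ⟨_, ⟨y, rfl⟩, hy⟩
  rw [extendHom_apply] at hy
  have h1 := congrArg Prod.fst (hh.1.injective hy)
  simp [wreath] at h1

end NormalGeneration

end EndsSpace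

theorem mainTheorem3 {E : Type*} [TopologicalSpace E] [CompactSpace E]
    [TopologicalSpace.MetrizableSpace E] [TotallyDisconnectedSpace E]
    (F : Set E) (hF : IsClosed F) (hE : EndsSpace.IsUniformlySelfSimilar F) :
    -- normally generated by a single involution
    (∃ τ : EndsSpace.HomeoPair F, IsInvolution τ ∧
      Subgroup.normalClosure {τ} = (⊤ : Subgroup (EndsSpace.HomeoPair F))) ∧
    -- half-spaces exist, and for each half-space `H` the group is normally generated by an
    -- `H`-translation
    (∃ H : Set E, EndsSpace.IsHalfSpace F H) ∧
    (∀ H : Set E, EndsSpace.IsHalfSpace F H →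
      ∃ φ : EndsSpace.HomeoPair F, EndsSpace.IsHTranslation F H φ ∧
        Subgroup.normalClosure {φ} = (⊤ : Subgroup (EndsSpace.HomeoPair F))) ∧
    -- uniformly perfect
    IsUniformlyPerfect (EndsSpace.HomeoPair F) ∧
    -- the explicit bounds
    (∀ g : EndsSpace.HomeoPair F,
      IsProductOfAtMost 3 IsCommutator g ∧
      IsProductOfAtMost 6 (fun φ => ∃ H : Set E, EndsSpace.IsHTranslation F H φ) g ∧
      IsProductOfAtMost 12 IsInvolution g) := by
  have : SecondCountableTopology E := by
    let := TopologicalSpace.metrizableSpaceMetric E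
    infer_instance
  obtain ⟨H, hH⟩ := hE.exists_isHalfSpace
  refine ⟨?_, ⟨H, hH⟩, fun H hH => ?_, ⟨3, hE.isProductOfAtMost_three_isCommutator hF⟩,
    fun g => ⟨hE.isProductOfAtMost_three_isCommutator hF g,
      hE.isProductOfAtMost_six_isHTranslation hF g,
      hE.isProductOfAtMost_twelve_isInvolution hF g⟩⟩
  · obtain ⟨τ, hτ, hd⟩ := hE.exists_isInvolution_disjoint hF hH
    exact ⟨τ, hτ, hE.normalClosure_eq_top hF hH hd⟩
  · obtain ⟨-, φ, -, -, -, -, -, -, hφ, -⟩ :=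
      EndsSpace.SupportedIn.exists_factorizations hF hE hH (g := 1) fun x _ => rfl
    exact ⟨φ, hφ, hE.normalClosure_eq_top hF hH hφ.disjoint_image⟩
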